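/- Let $n\ge 1$, $N=2n$. Let $R$ be the algebra of complex upper triangular matrices $(M_{ij})_{i,j\in\mathbb Z}$, $S=(\delta_{i,j-1})$ the shift matrix, $R_{\mathbb Z/N}=\{M\in R: MS^N=S^NM\}$, and $\mathcal M_N=R_{\mathbb Z/N}/\langle S^N\rangle$ (a finite-dimensional algebra; the entries $M_{ij}$ with $j<i+N$ are well defined on it). Let $\varepsilon_i=1$ if $i\equiv 1,\dots,n$ and $\varepsilon_i=-1$ if $i\equiv n+1,\dots,N \pmod N$, and let $M^\dagger_{ij}=\varepsilon_i\varepsilon_jM_{N-j+1,N-i+1}$. Let $R^{\mathrm i}_{\mathbb Z/N}=\{M\in R_{\mathbb Z/N}: M=-M^\dagger\}$ and $R^{\mathrm c}_{\mathbb Z/N}=\{M\in R_{\mathbb Z/N}: M=M^\dagger\}$, and for $\mathrm a\in\{\mathrm i,\mathrm c\}$ let $\mathcal M^{\mathrm a}_N\subset\mathcal M_N$ be the image of $R^{\mathrm a}_{\mathbb Z/N}$ and $E^{\mathrm a}_N=\{M\in\mathcal M^{\mathrm a}_N: M^2=0,\ M_{ii}=0\ \forall i\}$. A link pattern $\pi$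 of type $\mathrm i$ is a partition of $\{1,\dots,n\}$ into pairs (chords) and points joined to a boundary $b$; a link pattern of type $\mathrm c$ is a partition of $\{1,\dots,n\}$ into pairs and, when $n$ is odd only, exactly one unpaired point. It defines an involution $\tilde\pi$ of $\{1,\dots,N\}$: if $\{j,k\}$ is a chord, $\tilde\pi$ swaps $j,k$ and swaps $N-j+1,N-k+1$; if $j$ is joined to $b$, $\tilde\pi$ swaps $j$ and $N-j+1$; if $j$ is unpaired, $\tilde\pi$ fixes $j$ and $N-j+1$. Let $\pi^{\mathrm a}_<$ be the $N\times N$ matrix vanishing for $j\le i$ and, for $i<j$, given by $(\pi^{\mathrm i}_<)_{ij}=-\delta_{i,\tilde\pi(j)}$ if $n<i$ and $\delta_{i,\tilde\pi(j)}$ otherwise, respectively $(\pi^{\mathrm c}_<)_{ij}=0$ if $i+j=N+1$, $-\delta_{i,\tilde\pi(j)}$ if $N-j+1<i\le n$, and $\delta_{i,\tilde\pi(j)}$ otherwise. Let $\tilde B_N$ be the group of invertible upper triangular $N\times N$ matrices $U$ with $U^{-1}=J^{-1}U^TJ$, where $J_{ij}=\delta_{i+j,N+1}\varepsilon_i$.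 Let $F^{\mathrm a}_\pi$ be the set of $M\in E^{\mathrm a}_N$ whose block $\mathsf U=(M_{ij})_{1\le i,j\le N}$ satisfies $U\mathsf UU^{-1}=\pi^{\mathrm a}_<$ for some $U\in\tilde B_N$, and let $E^{\mathrm a}_\pi$ be the Zariski closure of $F^{\mathrm a}_\pi$. Let $\underline\pi\in\mathcal M^{\mathrm a}_N$ be the periodic matrix of $\tilde\pi$ with diagonal zeroed out: for $i\le j<i+N$, $\underline\pi_{ij}$ is $\pm1$ if $i<j$ and $i\equiv\tilde\pi(j)\pmod N$, and $0$ otherwise, the signs extending those of $\pi^{\mathrm a}_<$ and chosen so that $\underline\pi\in\mathcal M^{\mathrm a}_N$: for the representatives $i,j\in\{1,\dots,N\}$ mod $N$ the sign is $-1$ for $\mathrm a=\mathrm i$ exactly when $i,j>n$, and for $\mathrm a=\mathrm c$ exactly when $i+j>N+1$ and exactly one of $i,j$ is $\le n$. Let $\tilde U_{\mathbb Z/N}$ be the group of $M\in R^\times$ such that $S^NM=\lambda MS^N$ and $MM^\dagger=\zeta$ for some $\lambda,\zeta\in\mathbb C^\times$, and $M_{ii}=1$ for all $i$; it acts on $\mathcal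 M_N$ by conjugation. Theorem. For every $n\ge1$, $\mathrm a\in\{\mathrm i,\mathrm c\}$ and every link pattern $\pi$ of type $\mathrm a$ on $n$ points, $$E^{\mathrm a}_\pi=\overline{\tilde U_{\mathbb Z/N}\cdot\{\underline\pi t\ :\ t\in R_{\mathbb Z/N}\text{ diagonal},\ \underline\pi t\in\mathcal M^{\mathrm a}_N\}},$$ the closure being the Zariski closure. -/

import Mathlib

noncomputable section

namespace BrauerLoop

/-- The algebra of complex upper triangular matrices with rows and columns indexed by `ℤ`
(product `(M * M') i j = ∑ k ∈ Icc i j, M i k * M' k j`). -/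
def R : Type := IncidenceAlgebra ℂ ℤ

instance : Ring R := inferInstanceAs (Ring (IncidenceAlgebra ℂ ℤ))

instance : Algebra ℂ R := inferInstanceAs (Algebra ℂ (IncidenceAlgebra ℂ ℤ))

instance : FunLike R ℤ (ℤ → ℂ) := inferInstanceAs (FunLike (IncidenceAlgebra ℂ ℤ) ℤ (ℤ → ℂ))

theorem R.ext {M M' : R} (h : ∀ i j, i ≤ j → M i j = M' i j) : M = M' :=
  IncidenceAlgebra.ext h

theorem R.apply_eq_zero (M : R) {i j : ℤ} (h : ¬ i ≤ j) : M i j = 0 :=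
  IncidenceAlgebra.apply_eq_zero_of_not_le h M

theorem R.mul_apply (M M' : R) (i j : ℤ) :
    (M * M') i j = ∑ k ∈ Finset.Icc i j, M i k * M' k j := rfl

theorem R.one_apply (i j : ℤ) : (1 : R) i j = if i = j then 1 else 0 := rfl

theorem R.add_apply (M M' : R) (i j : ℤ) : (M + M') i j = M i j + M' i j := rfl

theorem R.sub_apply (M M' : R) (i j : ℤ) : (M - M') i j = M i j - M' i j := rfl

theorem R.neg_apply (M : R) (i j : ℤ) : (-M) i j = -M i j := rfl

theorem R.smul_apply (c : ℂ) (M : R) (i j : ℤ) : (c • M) i j = c * M i j := rfl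

/-- The matrix with entries `f i j` for `f` vanishing below the diagonal. -/
def R.of (f : ℤ → ℤ → ℂ) (hf : ∀ i j, ¬ i ≤ j → f i j = 0) : R :=
  IncidenceAlgebra.mk f fun i j => hf i j

theorem R.of_apply (f : ℤ → ℤ → ℂ) (hf : ∀ i j, ¬ i ≤ j → f i j = 0) (i j : ℤ) :
    R.of f hf i j = f i j := rfl

/-- The shift matrix `S = (δ_{i, j-1})`. -/
def shift : R := R.of (fun i j => if j = i + 1 then 1 else 0) fun i j h => if_neg (by omega)

theorem shift_pow_apply (k : ℕ) (i j : ℤ) :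
    (shift ^ k) i j = if j = i + k then 1 else 0 := by
  induction k generalizing i j with
  | zero => simp [R.one_apply, eq_comm]
  | succ k ih =>
    rw [pow_succ, R.mul_apply]
    have h1 : ∀ x ∈ Finset.Icc i j, (shift ^ k) i x * shift x j
        = if x = i + k then (if j = i + (k + 1 : ℕ) then 1 else 0) else 0 := by
      intro x _
      rw [ih]
      change (if x = i + k then (1 : ℂ) else 0) * (if j = x + 1 then 1 else 0) = _
      by_cases hx : x = i + k
      · subst hx
        have : (j = i + k + 1) ↔ (j = i + (k + 1 : ℕ)) := by push_cast; omega
        simp [this]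
      · simp [hx]
    rw [Finset.sum_congr rfl h1, Finset.sum_ite_eq']
    by_cases hj : j = i + (k + 1 : ℕ)
    · rw [if_pos hj, if_pos]
      rw [Finset.mem_Icc]
      push_cast at hj
      omega
    · rw [if_neg hj, ite_self]

theorem shift_pow_mul_apply (k : ℕ) (M : R) (i j : ℤ) : (shift ^ k * M) i j = M (i + k) j := by
  rw [R.mul_apply]
  simp only [shift_pow_apply, ite_mul, one_mul, zero_mul, Finset.sum_ite_eq', Finset.mem_Icc]
  split_ifs with h
  · rfl
  · exact (R.apply_eq_zero M (by omega)).symm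

theorem mul_shift_pow_apply (k : ℕ) (M : R) (i j : ℤ) : (M * shift ^ k) i j = M i (j - k) := by
  rw [R.mul_apply]
  have h1 : ∀ x ∈ Finset.Icc i j, M i x * (shift ^ k) x j = if x = j - k then M i (j - k) else 0 := by
    intro x _
    rw [shift_pow_apply]
    by_cases hx : x = j - k
    · subst hx
      simp
    · rw [if_neg hx, if_neg (by omega), mul_zero]
  rw [Finset.sum_congr rfl h1, Finset.sum_ite_eq']
  split_ifs with h
  · rfl
  · rw [Finset.mem_Icc] at h
    exact (R.apply_eq_zero M (by omega)).symm

/-- The subalgebra `R_{ℤ/N}`, `N = 2 n`, of the matrices commuting with `S ^ N`. -/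
def RZ (n : ℕ) : Subalgebra ℂ R := Subalgebra.centralizer ℂ {shift ^ (2 * n)}

theorem mem_RZ_iff (n : ℕ) (M : R) :
    M ∈ RZ n ↔ ∀ i j : ℤ, M (i + 2 * n) (j + 2 * n) = M i j := by
  have h0 : M ∈ RZ n ↔ shift ^ (2 * n) * M = M * shift ^ (2 * n) := by
    simp [RZ, Subalgebra.mem_centralizer_iff]
  rw [h0]
  constructor
  · intro h i j
    have := congrArg (fun A : R => A i (j + 2 * n)) h
    simp only [shift_pow_mul_apply, mul_shift_pow_apply] at this
    simpa using this
  · intro h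
    refine R.ext fun i j _ => ?_
    rw [shift_pow_mul_apply, mul_shift_pow_apply]
    have := h i (j - 2 * n)
    simpa using this

/-- `S ^ N` as an element of `R_{ℤ/N}`. -/
def shiftN (n : ℕ) : RZ n :=
  ⟨shift ^ (2 * n), by simp [RZ, Subalgebra.mem_centralizer_iff]⟩

theorem shiftN_comm (n : ℕ) (M : RZ n) : shiftN n * M = M * shiftN n := by
  exact Subtype.ext ((Subalgebra.mem_centralizer_iff ℂ).1 M.2 _ rfl)

/-- The ideal `⟨S ^ N⟩` of `R_{ℤ/N}`; it is two-sided because `S ^ N` is central there. -/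
def idealS (n : ℕ) : Ideal (RZ n) := Ideal.span {shiftN n}

instance idealS_isTwoSided (n : ℕ) : (idealS n).IsTwoSided where
  mul_mem_of_left {a} b ha := by
    rw [idealS, Ideal.mem_span_singleton'] at ha ⊢
    obtain ⟨c, rfl⟩ := ha
    exact ⟨c * b, by rw [mul_assoc, mul_assoc, shiftN_comm]⟩

/-- The algebra `𝓜_N = R_{ℤ/N} / ⟨S ^ N⟩`, `N = 2 n`. -/
abbrev MN (n : ℕ) : Type := RZ n ⧸ idealS n

/-- The projection `R_{ℤ/N} → 𝓜_N`. -/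
def toMN (n : ℕ) : RZ n →ₐ[ℂ] MN n := Ideal.Quotient.mkₐ ℂ (idealS n)

theorem apply_eq_zero_of_mem_idealS (n : ℕ) (M : RZ n) (hM : M ∈ idealS n) (i j : ℤ)
    (h : j < i + 2 * n) : (M : R) i j = 0 := by
  rw [idealS, Ideal.mem_span_singleton'] at hM
  obtain ⟨c, rfl⟩ := hM
  change ((c : R) * shift ^ (2 * n)) i j = 0
  rw [mul_shift_pow_apply]
  exact R.apply_eq_zero _ (by push_cast; omega)

/-- The entry `M_{ij}` of `M ∈ 𝓜_N`; it is well defined for `j < i + N`, and set to `0`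
otherwise (there the entries of representatives are arbitrary). -/
def entry (n : ℕ) (i j : ℤ) (m : MN n) : ℂ :=
  if h : j < i + 2 * n then
    Quotient.liftOn' m (fun M : RZ n => (M : R) i j) (fun a b hab => by
      have hab' : a - b ∈ idealS n := by
        have h1 := (Submodule.quotientRel_def (idealS n)).1 hab
        exact h1
      have := apply_eq_zero_of_mem_idealS n _ hab' i j h
      exact sub_eq_zero.1 this)
  else 0

theorem entry_toMN (n : ℕ) (i j : ℤ) (h : j < i + 2 * n) (M : RZ n) :
    entry n i j (toMN n M) = (M : R) i j := by
  rw [entry, dif_pos h]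
  rfl

/-- The sign `ε_i`: `1` for `i = 1, …, n` mod `2 n` and `-1` for `i = n + 1, …, 2 n` mod `2 n`. -/
def eps (n : ℕ) (i : ℤ) : ℂ :=
  if 1 ≤ i % (2 * n : ℤ) ∧ i % (2 * n : ℤ) ≤ n then 1 else -1

/-- The adjoint `M† = J⁻¹ Mᵀ J`, that is `M†_{ij} = ε_i ε_j M_{N-j+1, N-i+1}`, where
`J_{ij} = δ_{i+j, N+1} ε_i`. -/
def dagger (n : ℕ) : R →ₗ[ℂ] R where
  toFun M :=
    R.of (fun i j => eps n i * eps n j * M (2 * n - j + 1) (2 * n - i + 1)) fun i j h => by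
      rw [R.apply_eq_zero M (by omega), mul_zero]
  map_add' M M' := by
    refine R.ext fun i j _ => ?_
    exact mul_add _ _ _
  map_smul' c M := by
    refine R.ext fun i j _ => ?_
    exact mul_left_comm _ _ _

/-- The two boundary types: `i` (identified) and `c` (closed). -/
inductive BType
  | identified
  | closed

/-- `R^i_{ℤ/N} = {M | M = -M†}` and `R^c_{ℤ/N} = {M | M = M†}`. -/
def RZa (n : ℕ) : BType → Submodule ℂ (RZ n)
  | .identified =>
    { carrier := {M | (M : R) = -dagger n M}
      add_mem' := fun {x y} hx hy => by
        simp only [Set.mem_ofPred_eq, Subalgebra.coe_add, map_add, neg_add] at hx hy ⊢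
        rw [← hx, ← hy]
      zero_mem' := by simp
      smul_mem' := fun c x hx => by
        simp only [Set.mem_ofPred_eq, Subalgebra.coe_smul, map_smul] at hx ⊢
        rw [← smul_neg (M := ℂ) (A := R), ← hx] }
  | .closed =>
    { carrier := {M | (M : R) = dagger n M}
      add_mem' := fun {x y} hx hy => by
        simp only [Set.mem_ofPred_eq, Subalgebra.coe_add, map_add] at hx hy ⊢
        rw [← hx, ← hy]
      zero_mem' := by simp
      smul_mem' := fun c x hx => by
        simp only [Set.mem_ofPred_eq, Subalgebra.coe_smul, map_smul] at hx ⊢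
        rw [← hx] }

/-- `𝓜^a_N = R^a_{ℤ/N} / (⟨S ^ N⟩ ∩ R^a_{ℤ/N})`, as a linear subspace of `𝓜_N`. -/
def MNa (n : ℕ) (a : BType) : Submodule ℂ (MN n) := (RZa n a).map (toMN n).toLinearMap

/-- The points of the Brauer loop scheme `E^a_N`. -/
def E (n : ℕ) (a : BType) : Set (MN n) :=
  {m | m ∈ MNa n a ∧ m ^ 2 = 0 ∧ ∀ i : ℤ, entry n i i m = 0}

/-- Zariski closure of a subset of a complex vector space: the common zeros of the polynomial
functions (polynomials in the linear forms) that vanish on the subset. -/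
def zariskiClosure {V : Type*} [AddCommGroup V] [Module ℂ V] (s : Set V) : Set V :=
  {x | ∀ p ∈ Algebra.adjoin ℂ (Set.range fun f : Module.Dual ℂ V => (f : V → ℂ)),
    (∀ y ∈ s, p y = 0) → p x = 0}

/-- Link patterns of size `n`. `toFun j = some k` with `k ≠ j` means that `j` and `k` are joined
by a chord (chords may cross), `toFun j = none` that `j` is joined to the boundary `b`, and
`toFun j = some j` that `j` is unpaired. For identified boundaries, each point is either on a chord
or joined to `b`; for closed boundaries, all points are on chords, but for a single unpaired one
when `n` is odd. -/
structure LinkPattern (n : ℕ) (a : BType) where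
  toFun : Fin n → Option (Fin n)
  symm : ∀ j k, toFun j = some k → toFun k = some j
  admissible : match a with
    | .identified => ∀ j, toFun j ≠ some j
    | .closed => (∀ j, toFun j ≠ none) ∧
        (Finset.univ.filter fun j => toFun j = some j).card = n % 2

/-- The inclusion of `{1, …, n}` into `{1, …, 2 n}`; both are written with indices from `0`. -/
def incl (n : ℕ) : Fin n → Fin (2 * n) := Fin.castLE (by omega)

/-- The involution `π̃` of `{1, …, 2 n}` given by `π`: if `π j = k ≠ b` then `π̃ j = k` and
`π̃ (N - j + 1) = N - k + 1`; if `π j = b` then `π̃` swaps `j` and `N - j + 1`.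
With indices from `0`, `Fin.rev` is `j ↦ N - j + 1`. -/
def LinkPattern.tilde {n : ℕ} {a : BType} (π : LinkPattern n a) (j : Fin (2 * n)) : Fin (2 * n) :=
  if h : (j : ℕ) < n then
    match π.toFun ⟨j, h⟩ with
    | some k => incl n k
    | none => j.rev
  else
    match π.toFun ⟨j.rev, by rw [Fin.val_rev]; omega⟩ with
    | some k => (incl n k).rev
    | none => j.rev

/-- The upper triangular `N × N` matrix `π^a_<`. -/
def LinkPattern.upperMatrix {n : ℕ} :
    {a : BType} → LinkPattern n a → Matrix (Fin (2 * n)) (Fin (2 * n)) ℂ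
  | .identified, π => .of fun i j =>
      if j ≤ i then 0
      else if n ≤ (i : ℕ) then (if i = π.tilde j then -1 else 0)
      else (if i = π.tilde j then 1 else 0)
  | .closed, π => .of fun i j =>
      if j ≤ i then 0
      else if j = i.rev then 0
      else if j.rev < i ∧ (i : ℕ) < n then (if i = π.tilde j then -1 else 0)
      else (if i = π.tilde j then 1 else 0)

/-- The finite antidiagonal symplectic form `J`. -/
def Jfin (n : ℕ) : Matrix (Fin (2 * n)) (Fin (2 * n)) ℂ :=
  .of fun i j => if j = i.rev then (if (i : ℕ) < n then 1 else -1) else 0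

/-- The Borel subgroup `B̃_N`: the invertible upper triangular `U` with
`U⁻¹ = U† = J⁻¹ Uᵀ J`. -/
def borel (n : ℕ) : Set (GL (Fin (2 * n)) ℂ) :=
  {U | (∀ i j, j < i → U.1 i j = 0) ∧ U.1⁻¹ = (Jfin n)⁻¹ * U.1.transpose * Jfin n}

/-- The upper triangular part (rows and columns `1, …, N`) of `M ∈ 𝓜_N`. -/
def upperPart (n : ℕ) (m : MN n) : Matrix (Fin (2 * n)) (Fin (2 * n)) ℂ :=
  .of fun i j => entry n ((i : ℕ) + 1) ((j : ℕ) + 1) m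

/-- `F^a_π`: the `M ∈ E^a_N` whose upper triangular part is `B̃_N`-conjugate to `π^a_<`. -/
def LinkPattern.F {n : ℕ} {a : BType} (π : LinkPattern n a) : Set (MN n) :=
  {m | m ∈ E n a ∧ ∃ U ∈ borel n, U.1 * upperPart n m * U.1⁻¹ = π.upperMatrix}

/-- The component `E^a_π`, the closure of `F^a_π`. -/
def LinkPattern.component {n : ℕ} {a : BType} (π : LinkPattern n a) : Set (MN n) :=
  zariskiClosure π.F

/-- The residue of an integer mod `N` in `{1, …, N}`, written with indices from `0`. -/
def res (n : ℕ) [NeZero n] (i : ℤ) : Fin (2 * n) :=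
  ⟨((i - 1) % (2 * n : ℤ)).toNat, by
    have hn : 0 < n := Nat.pos_of_ne_zero (NeZero.ne n)
    have h1 := Int.emod_nonneg (i - 1) (b := (2 * n : ℤ)) (by omega)
    have h2 := Int.emod_lt_of_pos (i - 1) (b := (2 * n : ℤ)) (by omega)
    omega⟩

theorem res_add (n : ℕ) [NeZero n] (i : ℤ) : res n (i + 2 * n) = res n i := by
  apply Fin.ext
  simp only [res]
  rw [show i + 2 * (n : ℤ) - 1 = (i - 1) + 2 * n by ring, Int.add_emod_right]

/-- The signs of the entries of `π̲`; they extend those of `π^a_<` so that `π̲ ∈ 𝓜^a_N`. -/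
def sign (n : ℕ) : BType → Fin (2 * n) → Fin (2 * n) → ℂ
  | .identified, i, j => if n ≤ (i : ℕ) ∧ n ≤ (j : ℕ) then -1 else 1
  | .closed, i, j => if j.rev < i ∧ ((i : ℕ) < n ↔ n ≤ (j : ℕ)) then -1 else 1

/-- The matrix `π̲` of `π`, with diagonal zeroed out: its entries in the strip `i ≤ j < i + N` are
nonzero exactly at the `(i, j)` with `i < j` and `i = π̃ j` mod `N`, where they are `± 1`. -/
def LinkPattern.matrix {n : ℕ} [NeZero n] {a : BType} (π : LinkPattern n a) : RZ n :=
  ⟨R.of (fun i j =>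
      if i < j ∧ j < i + 2 * n ∧ res n i = π.tilde (res n j) then sign n a (res n i) (res n j)
      else 0) fun i j h => if_neg (by omega), by
    rw [mem_RZ_iff]
    intro i j
    simp only [R.of_apply, res_add, add_lt_add_iff_right]⟩

/-- The family `{π̲ t | t diagonal, π̲ t ∈ 𝓜^a_N}`. -/
def LinkPattern.family {n : ℕ} [NeZero n] {a : BType} (π : LinkPattern n a) : Set (MN n) :=
  {m | m ∈ MNa n a ∧
    ∃ t : RZ n, (∀ i j : ℤ, i ≠ j → (t : R) i j = 0) ∧ m = toMN n (π.matrix * t)}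

/-- `B_{ℤ/N} = {M ∈ Rˣ | ∃ λ ∈ ℂˣ, S^N M = λ M S^N}`. -/
def BZ (n : ℕ) : Set Rˣ :=
  {g | ∃ c : ℂ, c ≠ 0 ∧ shift ^ (2 * n) * (g : R) = c • ((g : R) * shift ^ (2 * n))}

/-- `B̃_{ℤ/N} = {M ∈ B_{ℤ/N} | ∃ ζ ∈ ℂˣ, M M† = ζ}`. -/
def BZtilde (n : ℕ) : Set Rˣ :=
  {g | g ∈ BZ n ∧ ∃ z : ℂ, z ≠ 0 ∧ (g : R) * dagger n g = z • (1 : R)}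

/-- `Ũ_{ℤ/N} = {M ∈ B̃_{ℤ/N} | M_{ii} = 1 for all i}`. -/
def UZtilde (n : ℕ) : Set Rˣ :=
  {g | g ∈ BZtilde n ∧ ∀ i : ℤ, (g : R) i i = 1}

/-- `Ũ_{ℤ/N} · s`, for the action on `𝓜_N` induced by the conjugation `X ↦ g X g⁻¹` of
representatives `X ∈ R_{ℤ/N}`. -/
def orbit (n : ℕ) (s : Set (MN n)) : Set (MN n) :=
  {m | ∃ g ∈ UZtilde n, ∃ X Y : RZ n, toMN n X ∈ s ∧
    (Y : R) = (g : R) * (X : R) * ((g⁻¹ : Rˣ) : R) ∧ m = toMN n Y}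

end BrauerLoop

end

namespace BrauerLoop

/-! ### Products, inverses and the adjoint in `R` -/

/-! Each of the two generating sets lies in the Zariski closure of the other. A polynomial vanishing
at all but finitely many points of an affine line vanishes on the whole line
(`mem_zariskiClosure_of_line`), so in both directions it is enough to prove membership after a
generic perturbation along a line.

From the orbit to `F` (`orbit_subset`): replace π̲t by π̲(t + c). For generic c every diagonal entry
of t + c is nonzero. The matrix then squares to zero modulo S^N because π̃ is an involution, and a
diagonal symplectic matrix made of square roots normalizes its upper block to π_<
(`isLift_of_diagonal`). Membership in `F` is preserved by unipotent conjugation.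

From `F` to the orbit (`F_subset`): let M be a periodic lift. Then M² = D S^N, where D is
self-adjoint and commutes with M. Adding to M a multiple cL supported beyond the upper block keeps
it in `F` and adds c·`label` to the diagonal of D, so for generic c the diagonal of D separates the
orbits of the group generated by π̃ and the reflection p ↦ N - p + 1. A product of Cayley transforms
makes D block diagonal for these orbits, up to entries irrelevant modulo S^N (`exists_conj_block`).
Since M commutes with D, it becomes block diagonal as well (`block_of_comm`).

A block has at most four indices. For a chord in the left half it is p < q < q' < p', where q = π̃ p
and the prime is the reflection. The entry (p, q) is a nonzero pivot (`umat_ne_zero`). Unipotent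
isometries supported in the blocks, together with M² = 0 and the symmetry under the adjoint, remove
every entry not at a position (i, π̃ i). What remains has the form π̲t (`IsReduced.mem_family`).

The algebra 𝓜_N is handled through two finite matrices: `umat`, the block of the first period, and
`lmat`, the next block, of which only the strictly lower part survives modulo S^N. -/

theorem R.mul_apply_of_le (M M' : R) {i j a b : ℤ} (ha : a ≤ i) (hb : j ≤ b) :
    (M * M') i j = ∑ k ∈ Finset.Icc a b, M i k * M' k j := by
  rw [R.mul_apply]
  refine Finset.sum_subset (Finset.Icc_subset_Icc ha hb) fun k _ hk => ?_
  rw [Finset.mem_Icc, not_and_or] at hk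
  rcases hk with hk | hk
  · rw [R.apply_eq_zero M hk, zero_mul]
  · rw [R.apply_eq_zero M' hk, mul_zero]

theorem R.mul_apply_self (M M' : R) (i : ℤ) : (M * M') i i = M i i * M' i i := by
  simp [R.mul_apply]

theorem R.sum_apply {ι : Type*} (s : Finset ι) (f : ι → R) (i j : ℤ) :
    (∑ k ∈ s, f k) i j = ∑ k ∈ s, f k i j := by
  classical
  induction s using Finset.induction_on with
  | empty => rfl
  | insert a s ha ih => rw [Finset.sum_insert ha, Finset.sum_insert ha, R.add_apply, ih]

theorem R.pow_apply_eq_zero (X : R) (hX : ∀ i, X i i = 0) (k : ℕ) {i j : ℤ} (h : j < i + k) :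
    (X ^ k) i j = 0 := by
  induction k generalizing i j with
  | zero => exact R.apply_eq_zero _ (by push_cast at h; omega)
  | succ k ih =>
    rw [pow_succ, R.mul_apply]
    refine Finset.sum_eq_zero fun l hl => ?_
    rw [Finset.mem_Icc] at hl
    by_cases hlj : l = j
    · rw [hlj, hX, mul_zero]
    · rw [ih (by push_cast at h; omega), zero_mul]

/-- The geometric series `∑ X ^ k`, for `X` with zero diagonal. -/
noncomputable def R.geom (X : R) : R :=
  R.of (fun i j => ∑ k ∈ Finset.range ((j - i).toNat + 1), (X ^ k) i j) fun _ _ h =>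
    Finset.sum_eq_zero fun _ _ => R.apply_eq_zero _ h

theorem R.geom_apply (X : R) (hX : ∀ i, X i i = 0) (K : ℕ) {i j : ℤ} (h : j < i + K) :
    R.geom X i j = (∑ k ∈ Finset.range K, X ^ k) i j := by
  by_cases hij : i ≤ j
  · rw [R.sum_apply]
    change ∑ k ∈ Finset.range ((j - i).toNat + 1), (X ^ k) i j = _
    refine Finset.sum_subset (Finset.range_subset_range.2 (by omega)) fun k _ hk => ?_
    rw [Finset.mem_range] at hk
    exact R.pow_apply_eq_zero X hX k (by omega)
  · rw [R.apply_eq_zero _ hij, R.apply_eq_zero _ hij]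

/-- The infinite series makes sense entrywise: `X ^ k` vanishes before the k-th superdiagonal, so at
each entry the series may be truncated and the finite sum telescopes. -/
theorem R.one_sub_mul_geom (X : R) (hX : ∀ i, X i i = 0) : (1 - X) * R.geom X = 1 := by
  refine R.ext fun i j hij => ?_
  have h1 : ((1 - X) * R.geom X) i j
      = ((1 - X) * ∑ k ∈ Finset.range ((j - i).toNat + 1), X ^ k) i j := by
    rw [R.mul_apply, R.mul_apply]
    refine Finset.sum_congr rfl fun l hl => ?_
    rw [Finset.mem_Icc] at hl
    rw [R.geom_apply X hX ((j - i).toNat + 1) (by push_cast; omega)]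
  rw [h1, mul_neg_geom_sum, R.sub_apply, R.pow_apply_eq_zero X hX _ (by push_cast; omega), sub_zero]

theorem R.geom_mul_one_sub (X : R) (hX : ∀ i, X i i = 0) : R.geom X * (1 - X) = 1 := by
  refine R.ext fun i j hij => ?_
  have h1 : (R.geom X * (1 - X)) i j
      = ((∑ k ∈ Finset.range ((j - i).toNat + 1), X ^ k) * (1 - X)) i j := by
    rw [R.mul_apply, R.mul_apply]
    refine Finset.sum_congr rfl fun l hl => ?_
    rw [Finset.mem_Icc] at hl
    rw [R.geom_apply X hX ((j - i).toNat + 1) (by push_cast; omega)]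
  rw [h1, geom_sum_mul_neg, R.sub_apply, R.pow_apply_eq_zero X hX _ (by push_cast; omega), sub_zero]

theorem R.geom_mem_RZ (n : ℕ) (X : R) (hX : X ∈ RZ n) : R.geom X ∈ RZ n := by
  rw [mem_RZ_iff]
  intro i j
  change ∑ k ∈ Finset.range ((j + 2 * n - (i + 2 * n)).toNat + 1), _
    = ∑ k ∈ Finset.range ((j - i).toNat + 1), _
  rw [show j + 2 * n - (i + 2 * n) = j - i by ring]
  exact Finset.sum_congr rfl fun k _ => (mem_RZ_iff n _).1 (pow_mem hX k) i j

theorem R.geom_apply_self (X : R) (hX : ∀ i, X i i = 0) (i : ℤ) : R.geom X i i = 1 := by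
  have := congrArg (fun A : R => A i i) (R.one_sub_mul_geom X hX)
  simpa [R.mul_apply_self, R.sub_apply, R.one_apply, hX] using this

/-! ### The adjoint as an anti-involution of `R` -/

theorem eps_mul_self (n : ℕ) (i : ℤ) : eps n i * eps n i = 1 := by
  unfold eps; split_ifs <;> norm_num

theorem eps_add (n : ℕ) (i : ℤ) : eps n (i + 2 * n) = eps n i := by
  simp [eps]

theorem eps_add_mul (n : ℕ) (i m : ℤ) : eps n (i + 2 * n * m) = eps n i := by
  simp [eps]

theorem dagger_apply (n : ℕ) (M : R) (i j : ℤ) :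
    dagger n M i j = eps n i * eps n j * M (2 * n - j + 1) (2 * n - i + 1) := rfl

theorem eps_mirror (n : ℕ) [NeZero n] (i : ℤ) : eps n (2 * n - i + 1) = -eps n i := by
  have hn : 0 < n := Nat.pos_of_ne_zero (NeZero.ne n)
  obtain ⟨h1, h2⟩ : 0 ≤ i % (2 * n : ℤ) ∧ i % (2 * n : ℤ) < 2 * n :=
    ⟨Int.emod_nonneg _ (by omega), Int.emod_lt_of_pos _ (by omega)⟩
  have h3 : (2 * n - i + 1) % (2 * n : ℤ) = (2 * n - i % (2 * n : ℤ) + 1) % (2 * n : ℤ) := by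
    rw [show 2 * (n : ℤ) - i + 1 = (2 * n - i % (2 * n : ℤ) + 1) + 2 * n * -(i / (2 * n : ℤ)) by
      have := Int.emod_add_mul_ediv i (2 * n : ℤ)
      linarith, Int.add_mul_emod_self_left]
  unfold eps
  rw [h3]
  generalize i % (2 * n : ℤ) = r at h1 h2
  -- Residues 0 and 1 are exchanged across the end of a period, so they wrap around and are treated
  -- separately.
  rcases lt_or_ge 1 r with hr | hr
  · rw [Int.emod_eq_of_lt (by omega) (by omega)]
    by_cases h : r ≤ n
    · rw [if_neg (by omega), if_pos (by omega)]
    · rw [if_pos (by omega), if_neg (by omega), neg_neg]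
  · rw [show 2 * (n : ℤ) - r + 1 = (1 - r) + 2 * n * 1 by ring, Int.add_mul_emod_self_left,
      Int.emod_eq_of_lt (by omega) (by omega)]
    by_cases h : r = 0
    · rw [if_pos (by omega), if_neg (by omega), neg_neg]
    · rw [if_neg (by omega), if_pos (by omega)]

theorem dagger_mul (n : ℕ) (M M' : R) : dagger n (M * M') = dagger n M' * dagger n M := by
  refine R.ext fun i j _ => ?_
  rw [dagger_apply, R.mul_apply, R.mul_apply, Finset.mul_sum]
  refine Finset.sum_nbij' (fun k => 2 * n - k + 1) (fun k => 2 * n - k + 1) ?_ ?_ ?_ ?_ ?_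
  · intro k hk; rw [Finset.mem_Icc] at hk ⊢; omega
  · intro k hk; rw [Finset.mem_Icc] at hk ⊢; omega
  · intro k _; ring
  · intro k _; ring
  · intro k _
    rw [dagger_apply, dagger_apply, show 2 * (n : ℤ) - (2 * n - k + 1) + 1 = k by ring]
    linear_combination (-eps n i * eps n j * M (2 * n - j + 1) k * M' k (2 * n - i + 1)) *
      eps_mul_self n (2 * n - k + 1)

theorem dagger_one (n : ℕ) : dagger n 1 = 1 := by
  refine R.ext fun i j _ => ?_
  rw [dagger_apply, R.one_apply, R.one_apply]
  by_cases h : i = j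
  · rw [if_pos h, if_pos (by omega), h, mul_one, eps_mul_self]
  · rw [if_neg h, if_neg (by omega), mul_zero]

theorem dagger_dagger (n : ℕ) [NeZero n] (M : R) : dagger n (dagger n M) = M := by
  refine R.ext fun i j _ => ?_
  rw [dagger_apply, dagger_apply, eps_mirror, eps_mirror,
    show 2 * (n : ℤ) - (2 * n - i + 1) + 1 = i by ring,
    show 2 * (n : ℤ) - (2 * n - j + 1) + 1 = j by ring]
  linear_combination M i j * eps_mul_self n i * (eps n j * eps n j) + M i j * eps_mul_self n j

theorem dagger_mem_RZ (n : ℕ) (M : R) (hM : M ∈ RZ n) : dagger n M ∈ RZ n := by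
  rw [mem_RZ_iff] at hM ⊢
  intro i j
  rw [dagger_apply, dagger_apply, eps_add, eps_add, ← hM (2 * n - (j + 2 * n) + 1),
    show 2 * (n : ℤ) - (j + 2 * n) + 1 + 2 * n = 2 * n - j + 1 by ring,
    show 2 * (n : ℤ) - (i + 2 * n) + 1 + 2 * n = 2 * n - i + 1 by ring]

theorem dagger_shift_pow (n : ℕ) : dagger n (shift ^ (2 * n)) = shift ^ (2 * n) := by
  refine R.ext fun i j _ => ?_
  rw [dagger_apply, shift_pow_apply, shift_pow_apply]
  push_cast
  by_cases h : j = i + 2 * n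
  · rw [if_pos h, if_pos (by omega), h, eps_add, mul_one, eps_mul_self]
  · rw [if_neg h, if_neg (by omega), mul_zero]

/-- The sign in `R^a_{ℤ/N} = {M | M = ± M†}`. -/
def eta : BType → ℂ
  | .identified => -1
  | .closed => 1

theorem eta_mul_self (a : BType) : eta a * eta a = 1 := by cases a <;> simp [eta]

theorem mem_RZa_iff {n : ℕ} {a : BType} {M : RZ n} :
    M ∈ RZa n a ↔ dagger n M = eta a • (M : R) := by
  cases a
  · change (M : R) = -dagger n M ↔ _
    rw [eta, neg_one_smul]
    exact ⟨fun h => by rw [eq_neg_iff_add_eq_zero] at h; exact eq_neg_of_add_eq_zero_right h,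
      fun h => by rw [h, neg_neg]⟩
  · change (M : R) = dagger n M ↔ _
    rw [eta, one_smul, eq_comm]

/-! ### Unipotent isometries and the orbits -/

/-- `g` is an element of `Ũ_{ℤ/N}` and `h` is its inverse. -/
structure IsUni (n : ℕ) (g h : RZ n) : Prop where
  mul_inv : g * h = 1
  inv_mul : h * g = 1
  dagger_eq : dagger n g = h
  diag : ∀ i, (g : R) i i = 1

theorem IsUni.one (n : ℕ) : IsUni n 1 1 := ⟨one_mul 1, one_mul 1, dagger_one n, fun i => by
  simp [R.one_apply]⟩

theorem IsUni.mul {n : ℕ} {g h g' h' : RZ n} (H : IsUni n g h) (H' : IsUni n g' h') :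
    IsUni n (g * g') (h' * h) where
  mul_inv := by rw [mul_assoc, ← mul_assoc g', H'.mul_inv, one_mul, H.mul_inv]
  inv_mul := by rw [mul_assoc, ← mul_assoc h, H.inv_mul, one_mul, H'.inv_mul]
  dagger_eq := by
    rw [Subalgebra.coe_mul, dagger_mul, H.dagger_eq, H'.dagger_eq, Subalgebra.coe_mul]
  diag i := by rw [Subalgebra.coe_mul, R.mul_apply_self, H.diag, H'.diag, one_mul]

theorem IsUni.diag_inv {n : ℕ} {g h : RZ n} (H : IsUni n g h) (i : ℤ) : (h : R) i i = 1 := by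
  have := congrArg (fun A : RZ n => (A : R) i i) H.mul_inv
  simpa [R.mul_apply_self, R.one_apply, H.diag] using this

theorem IsUni.symm {n : ℕ} [NeZero n] {g h : RZ n} (H : IsUni n g h) : IsUni n h g :=
  ⟨H.inv_mul, H.mul_inv, by rw [← H.dagger_eq, dagger_dagger], H.diag_inv⟩

theorem IsUni.conj_mem_RZa {n : ℕ} [NeZero n] {a : BType} {g h M : RZ n} (H : IsUni n g h)
    (hM : M ∈ RZa n a) : g * M * h ∈ RZa n a := by
  rw [mem_RZa_iff] at hM ⊢
  rw [Subalgebra.coe_mul, Subalgebra.coe_mul, dagger_mul, dagger_mul, hM, H.dagger_eq,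
    H.symm.dagger_eq, smul_mul_assoc, mul_smul_comm, mul_assoc]

/-- The Cayley transform: a strictly upper triangular `X` with `X† = -X` gives
`g = (1 - X / 2)⁻¹ (1 + X / 2)` in `Ũ_{ℤ/N}`. -/
theorem exists_cayley {n : ℕ} (X : RZ n) (hX : ∀ i, (X : R) i i = 0)
    (hd : dagger n X = -(X : R)) :
    ∃ g h : RZ n, IsUni n g h ∧ (1 - (2⁻¹ : ℂ) • X) * g = 1 + (2⁻¹ : ℂ) • X ∧
      h * (1 + (2⁻¹ : ℂ) • X) = 1 - (2⁻¹ : ℂ) • X := by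
  set Y : RZ n := (2⁻¹ : ℂ) • X with hY
  have hY0 : ∀ i, (Y : R) i i = 0 := fun i => by
    change ((2⁻¹ : ℂ) • (X : R)) i i = 0
    rw [R.smul_apply, hX, mul_zero]
  have hY0' : ∀ i, (-(Y : R)) i i = 0 := fun i => by rw [R.neg_apply, hY0, neg_zero]
  have hYd : dagger n Y = -(Y : R) := by
    change dagger n ((2⁻¹ : ℂ) • (X : R)) = -((2⁻¹ : ℂ) • (X : R))
    rw [map_smul, hd, smul_neg]
  set p : RZ n := ⟨R.geom Y, R.geom_mem_RZ n _ Y.2⟩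
  set q : RZ n := ⟨R.geom (-(Y : R)), R.geom_mem_RZ n _ (-Y).2⟩
  have hp1 : (1 - Y) * p = 1 := Subtype.ext (R.one_sub_mul_geom _ hY0)
  have hp2 : p * (1 - Y) = 1 := Subtype.ext (R.geom_mul_one_sub _ hY0)
  have hq1 : (1 + Y) * q = 1 := by
    have : (1 - -Y) * q = 1 := Subtype.ext (R.one_sub_mul_geom _ hY0')
    rwa [sub_neg_eq_add] at this
  have hq2 : q * (1 + Y) = 1 := by
    have : q * (1 - -Y) = 1 := Subtype.ext (R.geom_mul_one_sub _ hY0')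
    rwa [sub_neg_eq_add] at this
  have hcomm : (1 + Y) * (1 - Y) = (1 - Y) * (1 + Y) := by noncomm_ring
  have hc : q * (1 - Y) = (1 - Y) * q := by
    calc q * (1 - Y) = q * ((1 - Y) * (1 + Y)) * q := by rw [mul_assoc, mul_assoc, hq1, mul_one]
      _ = (1 - Y) * q := by rw [← hcomm, ← mul_assoc, hq2, one_mul]
  -- The adjoint sends `1 - Y` to `1 + Y`, hence exchanges their inverses. This is what makes the
  -- Cayley transform an isometry.
  have hdp : dagger n p = (q : R) := by
    have h1 : dagger n ((p * (1 - Y) : RZ n) : R) = 1 := by rw [hp2]; exact dagger_one n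
    have h2 : (1 + (Y : R)) * dagger n p = 1 := by
      rw [Subalgebra.coe_mul, dagger_mul] at h1
      change dagger n (1 - (Y : R)) * _ = 1 at h1
      rwa [map_sub, dagger_one, hYd, sub_neg_eq_add] at h1
    have h3 : (q : R) * (1 + (Y : R)) = 1 := congrArg Subtype.val hq2
    calc dagger n p = (q : R) * (1 + (Y : R)) * dagger n p := by rw [h3, one_mul]
      _ = q := by rw [mul_assoc, h2, mul_one]
  refine ⟨p * (1 + Y), q * (1 - Y), ⟨?_, ?_, ?_, ?_⟩, ?_, ?_⟩
  · rw [mul_assoc, ← mul_assoc (1 + Y), hq1, one_mul, hp2]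
  · rw [mul_assoc, ← mul_assoc (1 - Y), hp1, one_mul, hq2]
  · rw [Subalgebra.coe_mul, dagger_mul, hdp, hc]
    change dagger n (1 + (Y : R)) * _ = (1 - (Y : R)) * _
    rw [map_add, dagger_one, hYd, sub_eq_add_neg]
  · intro i
    rw [Subalgebra.coe_mul, R.mul_apply_self]
    change R.geom Y i i * (1 + (Y : R)) i i = 1
    rw [R.geom_apply_self _ hY0, R.add_apply, hY0, R.one_apply]
    simp
  · rw [← mul_assoc, hp1, one_mul]
  · rw [hc, mul_assoc, hq2, mul_one]

/-- The unit diagonal forces both scalars λ and ζ to be 1, as single entries of the two relations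
show. Hence g is periodic with inverse g†, and the action takes place inside `RZ n`. -/
theorem mem_orbit_iff {n : ℕ} {s : Set (MN n)} {m : MN n} :
    m ∈ orbit n s ↔ ∃ g h : RZ n, IsUni n g h ∧ ∃ x ∈ s, m = toMN n g * x * toMN n h := by
  constructor
  · rintro ⟨g, ⟨⟨⟨c, hc, hg⟩, z, hz, hgz⟩, hd⟩, X, Y, hX, hY, rfl⟩
    have hc1 : c = 1 := by
      have := congrArg (fun A : R => A 0 (0 + (2 * n : ℕ))) hg
      simp only [shift_pow_mul_apply, mul_shift_pow_apply, R.smul_apply, hd] at this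
      simpa [hd] using this.symm
    have hz1 : z = 1 := by
      have := congrArg (fun A : R => A 0 0) hgz
      simp only [R.mul_apply_self, dagger_apply, R.smul_apply, hd, eps_mul_self] at this
      simpa [R.one_apply] using this.symm
    rw [hz1, one_smul] at hgz
    have hgR : (g : R) ∈ RZ n := by
      rw [RZ, Subalgebra.mem_centralizer_iff]
      rintro _ rfl
      rw [hg, hc1, one_smul]
    have hgi : ((g⁻¹ : Rˣ) : R) = dagger n g := by
      rw [← mul_one ((g⁻¹ : Rˣ) : R), ← hgz, ← mul_assoc, Units.inv_mul, one_mul]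
    refine ⟨⟨g, hgR⟩, ⟨((g⁻¹ : Rˣ) : R), hgi ▸ dagger_mem_RZ n _ hgR⟩,
      ⟨Subtype.ext (Units.mul_inv g), Subtype.ext (Units.inv_mul g), hgi.symm, hd⟩, _, hX, ?_⟩
    rw [← map_mul, ← map_mul]
    exact congrArg _ (Subtype.ext hY)
  · rintro ⟨g, h, H, x, hx, rfl⟩
    obtain ⟨X, rfl⟩ := Ideal.Quotient.mk_surjective x
    let u : Rˣ := ⟨g, h, congrArg Subtype.val H.mul_inv, congrArg Subtype.val H.inv_mul⟩
    refine ⟨u, ⟨⟨⟨1, one_ne_zero, ?_⟩, 1, one_ne_zero, ?_⟩, H.diag⟩, X, g * X * h, hx, rfl, ?_⟩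
    · rw [one_smul]
      exact (Subalgebra.mem_centralizer_iff ℂ).1 g.2 _ rfl
    · rw [one_smul]
      change (g : R) * dagger n g = 1
      rw [H.dagger_eq]
      exact congrArg Subtype.val H.mul_inv
    · rw [map_mul, map_mul]
      rfl

/-! ### The two blocks of a periodic matrix -/

/-- The integer congruent to `p + 1` in the `m`-th period. -/
def ix (n : ℕ) (p : Fin (2 * n)) (m : ℤ) : ℤ := (p : ℤ) + 1 + 2 * n * m

theorem exists_ix (n : ℕ) [NeZero n] (i : ℤ) : ∃ p m, i = ix n p m := by
  have hn : 0 < n := Nat.pos_of_ne_zero (NeZero.ne n)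
  have h1 := Int.emod_nonneg (i - 1) (b := (2 * n : ℤ)) (by omega)
  refine ⟨res n i, (i - 1) / (2 * n : ℤ), ?_⟩
  have := Int.emod_add_mul_ediv (i - 1) (2 * n : ℤ)
  simp only [ix, res]
  rw [Int.toNat_of_nonneg h1]
  linarith

theorem res_ix (n : ℕ) [NeZero n] (p : Fin (2 * n)) (m : ℤ) : res n (ix n p m) = p := by
  apply Fin.ext
  have hp := p.2
  simp only [ix, res]
  rw [show (p : ℤ) + 1 + 2 * n * m - 1 = p + 2 * n * m by ring, Int.add_mul_emod_self_left,
    Int.emod_eq_of_lt (by omega) (by omega), Int.toNat_natCast]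

theorem ix_add (n : ℕ) (p : Fin (2 * n)) (m k : ℤ) : ix n p (m + k) = ix n p m + 2 * n * k := by
  simp only [ix]; ring

theorem ix_lt_ix {n : ℕ} {p q : Fin (2 * n)} {m k : ℤ} :
    ix n p m < ix n q k ↔ m < k ∨ m = k ∧ p < q := by
  have hp := p.2
  have hq := q.2
  simp only [ix, Fin.lt_def]
  rcases lt_trichotomy m k with h | h | h
  · have : (2 * n : ℤ) * (m + 1) ≤ 2 * n * k := mul_le_mul_of_nonneg_left (by omega) (by omega)
    simp only [h, true_or, iff_true]
    linarith [show (p : ℤ) < 2 * n by omega, show (0 : ℤ) ≤ q by omega]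
  · subst h; omega
  · have : (2 * n : ℤ) * (k + 1) ≤ 2 * n * m := mul_le_mul_of_nonneg_left (by omega) (by omega)
    constructor
    · intro h1
      linarith [show (q : ℤ) < 2 * n by omega, show (0 : ℤ) ≤ p by omega]
    · omega

theorem ix_inj {n : ℕ} {p q : Fin (2 * n)} {m k : ℤ} : ix n p m = ix n q k ↔ m = k ∧ p = q := by
  constructor
  · intro h
    have h1 := (ix_lt_ix (n := n) (p := p) (q := q) (m := m) (k := k)).not.1 h.not_lt
    have h2 := (ix_lt_ix (n := n) (p := q) (q := p) (m := k) (k := m)).not.1 h.not_gt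
    have h3 : m = k := by omega
    exact ⟨h3, le_antisymm (not_lt.1 fun h4 => h2 (Or.inr ⟨h3.symm, h4⟩))
      (not_lt.1 fun h4 => h1 (Or.inr ⟨h3, h4⟩))⟩
  · rintro ⟨rfl, rfl⟩; rfl

theorem ix_le_ix {n : ℕ} {p q : Fin (2 * n)} {m k : ℤ} :
    ix n p m ≤ ix n q k ↔ m < k ∨ m = k ∧ p ≤ q := by
  rw [le_iff_lt_or_eq, ix_lt_ix, ix_inj, le_iff_lt_or_eq]
  tauto

theorem ix_mirror (n : ℕ) (p : Fin (2 * n)) (m : ℤ) :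
    2 * n - ix n p m + 1 = ix n p.rev (-m) := by
  have := p.2
  simp only [ix, Fin.val_rev]
  push_cast [show (p : ℕ) + 1 ≤ 2 * n by omega]
  ring

theorem RZ.apply_add_mul {n : ℕ} (M : RZ n) (i j m : ℤ) :
    (M : R) (i + 2 * n * m) (j + 2 * n * m) = (M : R) i j := by
  have h := (mem_RZ_iff n _).1 M.2
  induction m with
  | zero => simp
  | succ k ih =>
    rw [← ih, ← h (i + 2 * n * k)]
    ring_nf
  | pred k ih =>
    rw [← ih, ← h (i + 2 * n * (-k - 1))]
    ring_nf

theorem sum_Icc_period (n : ℕ) (m : ℤ) (f : ℤ → ℂ) :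
    ∑ k ∈ Finset.Icc (1 + 2 * n * m) (2 * n + 2 * n * m), f k =
      ∑ p : Fin (2 * n), f (ix n p m) := by
  symm
  refine Finset.sum_bij (fun p _ => ix n p m) ?_ ?_ ?_ ?_
  · intro p _
    have := p.2
    simp only [ix, Finset.mem_Icc]
    omega
  · intro p _ q _ h
    exact (ix_inj.1 h).2
  · intro k hk
    rw [Finset.mem_Icc] at hk
    refine ⟨⟨(k - 1 - 2 * n * m).toNat, by omega⟩, Finset.mem_univ _, ?_⟩
    simp only [ix]
    rw [Int.toNat_of_nonneg (by omega)]
    ring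
  · intro p _; rfl

/-- The block in rows and columns `1, …, N`. -/
def umat (n : ℕ) : RZ n →ₗ[ℂ] Matrix (Fin (2 * n)) (Fin (2 * n)) ℂ where
  toFun M := .of fun p q => (M : R) (ix n p 0) (ix n q 0)
  map_add' _ _ := rfl
  map_smul' _ _ := rfl

/-- The block in rows `1, …, N` and columns `N + 1, …, 2 N`. -/
def lmat (n : ℕ) : RZ n →ₗ[ℂ] Matrix (Fin (2 * n)) (Fin (2 * n)) ℂ where
  toFun M := .of fun p q => (M : R) (ix n p 0) (ix n q 1)
  map_add' _ _ := rfl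
  map_smul' _ _ := rfl

theorem umat_apply {n : ℕ} (M : RZ n) (p q : Fin (2 * n)) :
    umat n M p q = (M : R) (ix n p 0) (ix n q 0) := rfl

theorem lmat_apply {n : ℕ} (M : RZ n) (p q : Fin (2 * n)) :
    lmat n M p q = (M : R) (ix n p 0) (ix n q 1) := rfl

theorem RZ.apply_ix {n : ℕ} (M : RZ n) (p q : Fin (2 * n)) (m : ℤ) :
    (M : R) (ix n p m) (ix n q m) = umat n M p q := by
  rw [umat_apply, ← RZ.apply_add_mul M (ix n p 0) (ix n q 0) m, ← ix_add, ← ix_add,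
    zero_add]

theorem RZ.apply_ix_add_one {n : ℕ} (M : RZ n) (p q : Fin (2 * n)) (m : ℤ) :
    (M : R) (ix n p m) (ix n q (m + 1)) = lmat n M p q := by
  rw [lmat_apply, ← RZ.apply_add_mul M (ix n p 0) (ix n q 1) m, ← ix_add, ← ix_add,
    zero_add, add_comm]

theorem umat_apply_of_lt {n : ℕ} (M : RZ n) {p q : Fin (2 * n)} (h : q < p) :
    umat n M p q = 0 :=
  R.apply_eq_zero _ (by rw [ix_le_ix]; simp [h])

theorem umat_mul {n : ℕ} (M M' : RZ n) : umat n (M * M') = umat n M * umat n M' := by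
  ext p q
  have hp := p.2
  have hq := q.2
  rw [umat_apply, Subalgebra.coe_mul, Matrix.mul_apply,
    R.mul_apply_of_le _ _ (a := 1 + 2 * n * 0) (b := 2 * n + 2 * n * 0) (by simp only [ix]; omega)
    (by simp only [ix]; omega), sum_Icc_period]
  rfl

/-- The summation index runs over two periods, one for each term. With `umat_mul`, this says that M
acts as `umat + z · lmat` modulo z². -/
theorem lmat_mul {n : ℕ} (M M' : RZ n) :
    lmat n (M * M') = umat n M * lmat n M' + lmat n M * umat n M' := by
  ext p q
  have hp := p.2
  have hq := q.2
  have hsplit : Finset.Icc (1 + 2 * n * 0 : ℤ) (2 * n + 2 * n * 1)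
      = Finset.Icc (1 + 2 * n * 0 : ℤ) (2 * n + 2 * n * 0) ∪
        Finset.Icc (1 + 2 * n * 1 : ℤ) (2 * n + 2 * n * 1) := by
    ext k
    simp only [Finset.mem_union, Finset.mem_Icc]
    omega
  have hdisj : Disjoint (Finset.Icc (1 + 2 * n * 0 : ℤ) (2 * n + 2 * n * 0))
      (Finset.Icc (1 + 2 * n * 1 : ℤ) (2 * n + 2 * n * 1)) := by
    rw [Finset.disjoint_left]
    intro k
    simp only [Finset.mem_Icc]
    omega
  rw [lmat_apply, Subalgebra.coe_mul, Matrix.add_apply, Matrix.mul_apply, Matrix.mul_apply,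
    R.mul_apply_of_le _ _ (a := 1 + 2 * n * 0) (b := 2 * n + 2 * n * 1) (by simp only [ix]; omega)
    (by simp only [ix]; omega), hsplit, Finset.sum_union hdisj, sum_Icc_period, sum_Icc_period]
  congr 1
  refine Finset.sum_congr rfl fun l _ => ?_
  rw [RZ.apply_ix]
  rfl

theorem umat_one (n : ℕ) : umat n 1 = 1 := by
  ext p q
  rw [umat_apply, Matrix.one_apply]
  change (1 : R) _ _ = _
  simp [R.one_apply, ix_inj]

theorem lmat_one (n : ℕ) : lmat n 1 = 0 := by
  ext p q
  rw [lmat_apply]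
  change (1 : R) _ _ = _
  simp [R.one_apply, ix_inj]

theorem upperPart_toMN {n : ℕ} (M : RZ n) : upperPart n (toMN n M) = umat n M := by
  ext p q
  have := q.2
  change entry n _ _ _ = _
  rw [entry_toMN _ _ _ (by omega), umat_apply]
  simp [ix]

/-- Up to periodicity, the entries with i ≤ j < i + N are those of the upper block and of the
strictly lower part of the next one. When they vanish, shifting the columns by N gives an upper
triangular quotient by S^N. -/
theorem mem_idealS_iff {n : ℕ} [NeZero n] {M : RZ n} :
    M ∈ idealS n ↔ umat n M = 0 ∧ ∀ p q, q < p → lmat n M p q = 0 := by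
  constructor
  · intro h
    refine ⟨?_, fun p q hpq => apply_eq_zero_of_mem_idealS n M h _ _ ?_⟩
    · ext p q
      have := q.2
      exact apply_eq_zero_of_mem_idealS n M h _ _ (by simp only [ix]; omega)
    · rw [Fin.lt_def] at hpq
      simp only [ix]; omega
  · rintro ⟨hU, hL⟩
    have h0 : ∀ i j : ℤ, j < i + 2 * n → (M : R) i j = 0 := by
      intro i j hij
      obtain ⟨p, m, rfl⟩ := exists_ix n i
      obtain ⟨q, k, rfl⟩ := exists_ix n j
      rw [show ix n p m + 2 * n = ix n p (m + 1) by rw [ix_add, mul_one], ix_lt_ix] at hij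
      rcases lt_trichotomy k m with h | rfl | h
      · exact R.apply_eq_zero _ (by rw [ix_le_ix]; omega)
      · rw [RZ.apply_ix, hU]; rfl
      · obtain rfl : k = m + 1 := by omega
        rw [RZ.apply_ix_add_one]
        exact hL p q (by simpa using hij)
    have hc : R.of (fun i j => (M : R) i (j + 2 * n)) (fun i j h => h0 _ _ (by omega)) ∈ RZ n := by
      rw [mem_RZ_iff]
      intro i j
      exact (mem_RZ_iff n _).1 M.2 i (j + 2 * n)
    rw [idealS, Ideal.mem_span_singleton']
    refine ⟨⟨_, hc⟩, Subtype.ext (R.ext fun i j _ => ?_)⟩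
    change (R.of _ _ * shift ^ (2 * n)) i j = _
    rw [mul_shift_pow_apply, R.of_apply]
    simp

theorem toMN_eq_iff {n : ℕ} [NeZero n] {M M' : RZ n} :
    toMN n M = toMN n M' ↔
      umat n M = umat n M' ∧ ∀ p q, q < p → lmat n M p q = lmat n M' p q := by
  have h : toMN n M = toMN n M' ↔ M - M' ∈ idealS n := Ideal.Quotient.eq
  rw [h, mem_idealS_iff, map_sub, map_sub, sub_eq_zero]
  simp only [Matrix.sub_apply, sub_eq_zero]

theorem toMN_eq_zero_iff {n : ℕ} [NeZero n] {M : RZ n} :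
    toMN n M = 0 ↔ umat n M = 0 ∧ ∀ p q, q < p → lmat n M p q = 0 := by
  rw [← map_zero (toMN n), toMN_eq_iff, map_zero, map_zero]
  rfl

/-- The periodic matrix with the given blocks. -/
def lift (n : ℕ) [NeZero n] (A B : Matrix (Fin (2 * n)) (Fin (2 * n)) ℂ) : RZ n :=
  ⟨R.of (fun i j =>
      if i ≤ j then
        if (j - 1) / (2 * n : ℤ) = (i - 1) / (2 * n : ℤ) then A (res n i) (res n j)
        else if (j - 1) / (2 * n : ℤ) = (i - 1) / (2 * n : ℤ) + 1 then B (res n i) (res n j)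
        else 0
      else 0) fun _ _ h => if_neg h, by
    have hn : (2 * n : ℤ) ≠ 0 := by
      have := NeZero.ne n
      omega
    rw [mem_RZ_iff]
    intro i j
    have h1 : ∀ i : ℤ, (i + 2 * n - 1) / (2 * n : ℤ) = (i - 1) / (2 * n : ℤ) + 1 := fun i => by
      rw [show i + 2 * (n : ℤ) - 1 = i - 1 + 2 * n by ring, Int.add_ediv_of_dvd_right dvd_rfl,
        Int.ediv_self hn]
    simp only [R.of_apply, res_add, h1, add_le_add_iff_right, add_left_inj]⟩

theorem ix_div (n : ℕ) (p : Fin (2 * n)) (m : ℤ) : (ix n p m - 1) / (2 * n : ℤ) = m := by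
  have := p.2
  rw [ix, show (p : ℤ) + 1 + 2 * n * m - 1 = p + 2 * n * m by ring,
    Int.add_mul_ediv_left _ _ (by omega), Int.ediv_eq_zero_of_lt (by omega) (by omega), zero_add]

theorem lift_apply_ix {n : ℕ} [NeZero n] (A B : Matrix (Fin (2 * n)) (Fin (2 * n)) ℂ)
    (p q : Fin (2 * n)) (m k : ℤ) :
    (lift n A B : R) (ix n p m) (ix n q k) =
      if k = m then (if p ≤ q then A p q else 0) else if k = m + 1 then B p q else 0 := by
  change (if _ ≤ _ then _ else _ : ℂ) = _
  simp only [ix_div, res_ix, ix_le_ix]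
  split_ifs <;> first | rfl | omega

theorem umat_lift {n : ℕ} [NeZero n] (A B : Matrix (Fin (2 * n)) (Fin (2 * n)) ℂ)
    (hA : ∀ p q, q < p → A p q = 0) : umat n (lift n A B) = A := by
  ext p q
  rw [umat_apply, lift_apply_ix, if_pos rfl]
  split_ifs with h
  · rfl
  · rw [hA p q (not_le.1 h)]

theorem lmat_lift {n : ℕ} [NeZero n] (A B : Matrix (Fin (2 * n)) (Fin (2 * n)) ℂ) :
    lmat n (lift n A B) = B := by
  ext p q
  rw [lmat_apply, lift_apply_ix, if_neg one_ne_zero, if_pos (zero_add 1).symm]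

/-! ### The adjoint of the blocks -/

/-- The sign `ε` on `{1, …, N}`. -/
def sgn (n : ℕ) (p : Fin (2 * n)) : ℂ := if (p : ℕ) < n then 1 else -1

theorem sgn_mul_self {n : ℕ} (p : Fin (2 * n)) : sgn n p * sgn n p = 1 := by
  unfold sgn; split_ifs <;> norm_num

theorem sgn_rev {n : ℕ} (p : Fin (2 * n)) : sgn n p.rev = -sgn n p := by
  have := p.2
  simp only [sgn, Fin.val_rev]
  split_ifs <;> first | omega | norm_num

theorem eps_ix (n : ℕ) (p : Fin (2 * n)) (m : ℤ) : eps n (ix n p m) = sgn n p := by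
  have := p.2
  rw [ix, eps_add_mul, eps, sgn]
  rcases lt_or_ge ((p : ℕ) + 1) (2 * n) with h | h
  · rw [Int.emod_eq_of_lt (by omega) (by omega)]
    split_ifs <;> first | rfl | omega
  · rw [show (p : ℤ) + 1 = 2 * n by omega, Int.emod_self]
    split_ifs <;> first | rfl | omega

/-- The adjoint `J⁻¹ Aᵀ J` of an `N × N` matrix. -/
def dag (n : ℕ) (A : Matrix (Fin (2 * n)) (Fin (2 * n)) ℂ) : Matrix (Fin (2 * n)) (Fin (2 * n)) ℂ :=
  .of fun p q => sgn n p * sgn n q * A q.rev p.rev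

theorem dag_apply {n : ℕ} (A : Matrix (Fin (2 * n)) (Fin (2 * n)) ℂ) (p q : Fin (2 * n)) :
    dag n A p q = sgn n p * sgn n q * A q.rev p.rev := rfl

theorem Jfin_mul_self (n : ℕ) : Jfin n * Jfin n = -1 := by
  ext p q
  rw [Matrix.mul_apply, Finset.sum_eq_single p.rev]
  · have := p.2
    simp only [Jfin, Matrix.of_apply, if_true, Fin.rev_rev, Matrix.neg_apply, Matrix.one_apply,
      Fin.val_rev, eq_comm (a := p)]
    split_ifs <;> first | omega | norm_num
  · intro l _ hl
    simp [Jfin, hl]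
  · simp

theorem dag_eq (n : ℕ) (A : Matrix (Fin (2 * n)) (Fin (2 * n)) ℂ) :
    (Jfin n)⁻¹ * A.transpose * Jfin n = dag n A := by
  have hJ : (Jfin n)⁻¹ = -Jfin n :=
    Matrix.inv_eq_right_inv (by rw [mul_neg, Jfin_mul_self, neg_neg])
  ext p q
  rw [hJ, Matrix.mul_apply, Finset.sum_eq_single q.rev, Matrix.mul_apply,
    Finset.sum_eq_single p.rev, dag_apply]
  · have h1 : ∀ r : Fin (2 * n), Jfin n r r.rev = sgn n r := fun r => by simp [Jfin, sgn]
    have h2 : Jfin n q.rev q = -sgn n q := by rw [← sgn_rev, ← h1, Fin.rev_rev]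
    rw [Matrix.neg_apply, Matrix.transpose_apply, h1, h2]
    ring
  · intro l _ hl
    simp [Jfin, hl]
  · simp
  · intro l _ hl
    have : q ≠ l.rev := fun h => hl (by rw [h, Fin.rev_rev])
    simp [Jfin, this]
  · simp

theorem dag_mul {n : ℕ} (A B : Matrix (Fin (2 * n)) (Fin (2 * n)) ℂ) :
    dag n (A * B) = dag n B * dag n A := by
  ext p q
  rw [dag_apply, Matrix.mul_apply, Matrix.mul_apply, Finset.mul_sum]
  refine Fintype.sum_equiv Fin.revPerm _ _ fun l => ?_
  rw [dag_apply, dag_apply, Fin.revPerm_apply, Fin.rev_rev]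
  linear_combination (-sgn n p * sgn n q * A q.rev l * B l p.rev) * sgn_mul_self l.rev

theorem dag_dag {n : ℕ} (A : Matrix (Fin (2 * n)) (Fin (2 * n)) ℂ) : dag n (dag n A) = A := by
  ext p q
  rw [dag_apply, dag_apply, sgn_rev, sgn_rev, Fin.rev_rev, Fin.rev_rev]
  linear_combination A p q * sgn_mul_self p * (sgn n q * sgn n q) + A p q * sgn_mul_self q

theorem dagger_apply_ix {n : ℕ} [NeZero n] (M : R) (p q : Fin (2 * n)) (m k : ℤ) :
    dagger n M (ix n p m) (ix n q k) =
      sgn n p * sgn n q * M (ix n q.rev (-k)) (ix n p.rev (-m)) := by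
  rw [dagger_apply, eps_ix, eps_ix, ix_mirror, ix_mirror]

theorem dag_umat_of_dagger {n : ℕ} [NeZero n] {M M' : RZ n} (h : dagger n M = (M' : R)) :
    dag n (umat n M) = umat n M' := by
  ext p q
  rw [umat_apply, ← h, dagger_apply_ix, dag_apply, neg_zero]
  rfl

theorem dag_lmat_of_dagger {n : ℕ} [NeZero n] {M M' : RZ n} (h : dagger n M = (M' : R)) :
    dag n (lmat n M) = lmat n M' := by
  ext p q
  rw [lmat_apply, ← h, dagger_apply_ix, dag_apply, ← RZ.apply_ix_add_one M _ _ (-1), neg_zero]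
  rfl

theorem dagger_lift {n : ℕ} [NeZero n] (A B : Matrix (Fin (2 * n)) (Fin (2 * n)) ℂ) (c : ℂ)
    (hA : dag n A = c • A) (hB : dag n B = c • B) :
    dagger n (lift n A B) = c • (lift n A B : R) := by
  refine R.ext fun i j _ => ?_
  obtain ⟨p, m, rfl⟩ := exists_ix n i
  obtain ⟨q, k, rfl⟩ := exists_ix n j
  have hA' := congrFun (congrFun hA p) q
  have hB' := congrFun (congrFun hB p) q
  rw [dag_apply, Matrix.smul_apply, smul_eq_mul] at hA' hB'
  rw [dagger_apply_ix, R.smul_apply, lift_apply_ix, lift_apply_ix]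
  by_cases h1 : k = m
  · rw [if_pos (by omega), if_pos h1]
    by_cases h2 : p ≤ q
    · rw [if_pos (Fin.rev_le_rev.2 h2), if_pos h2, hA']
    · rw [if_neg (fun h => h2 (Fin.rev_le_rev.1 h)), if_neg h2, mul_zero, mul_zero]
  · rw [if_neg (by omega), if_neg h1]
    by_cases h2 : k = m + 1
    · rw [if_pos (by omega), if_pos h2, hB']
    · rw [if_neg (by omega), if_neg h2, mul_zero, mul_zero]

theorem lift_mem_RZa {n : ℕ} [NeZero n] {a : BType} (A B : Matrix (Fin (2 * n)) (Fin (2 * n)) ℂ)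
    (hA : dag n A = eta a • A) (hB : dag n B = eta a • B) : lift n A B ∈ RZa n a :=
  mem_RZa_iff.2 (dagger_lift A B _ hA hB)

theorem dag_umat_of_mem {n : ℕ} [NeZero n] {a : BType} {M : RZ n} (h : M ∈ RZa n a) :
    dag n (umat n M) = eta a • umat n M := by
  rw [← map_smul]
  exact dag_umat_of_dagger (mem_RZa_iff.1 h)

theorem dag_lmat_of_mem {n : ℕ} [NeZero n] {a : BType} {M : RZ n} (h : M ∈ RZa n a) :
    dag n (lmat n M) = eta a • lmat n M := by
  rw [← map_smul]
  exact dag_lmat_of_dagger (mem_RZa_iff.1 h)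

/-! ### Block diagonalization of self-adjoint periodic matrices -/

theorem mem_RZa_closed_iff {n : ℕ} {M : RZ n} : M ∈ RZa n .closed ↔ dagger n M = (M : R) := by
  rw [mem_RZa_iff, eta, one_smul]

/-- To first order, conjugation by the Cayley transform of X adds XD - DX. For X supported on the
m-th superdiagonal this changes D there by x_ij (D_jj - D_ii), and the separation of the diagonal
allows this to be set equal to -D_ij. -/
theorem exists_conj_succ {n : ℕ} [NeZero n] (κ : ℤ → ℕ) (hκ : ∀ i, κ (i + 2 * n) = κ i)
    (hκ' : ∀ i, κ (2 * n - i + 1) = κ i) (D : RZ n) (hD : D ∈ RZa n .closed)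
    (hne : ∀ i j, κ i ≠ κ j → (D : R) i i ≠ (D : R) j j) (m : ℕ) (hm : 0 < m)
    (hoff : ∀ i j : ℤ, j < i + m → κ i ≠ κ j → (D : R) i j = 0) :
    ∃ g h, IsUni n g h ∧ (∀ i, ((g * D * h : RZ n) : R) i i = (D : R) i i) ∧
      ∀ i j : ℤ, j < i + m + 1 → κ i ≠ κ j → ((g * D * h : RZ n) : R) i j = 0 := by
  rw [mem_RZa_closed_iff] at hD
  have hper := (mem_RZ_iff n _).1 D.2
  have hDd : ∀ i j, eps n i * eps n j * (D : R) (2 * n - j + 1) (2 * n - i + 1) = (D : R) i j :=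
    fun i j => congrArg (fun A : R => A i j) hD
  have hDd' : ∀ i, (D : R) (2 * n - i + 1) (2 * n - i + 1) = (D : R) i i := fun i => by
    have := hDd i i
    rwa [eps_mul_self, one_mul] at this
  -- Self-adjointness of D makes the numerators symmetric, while the denominators change sign under
  -- the reflection. Hence X† = -X, as the Cayley transform requires.
  let x : ℤ → ℤ → ℂ := fun i j =>
    if κ i ≠ κ j then (D : R) i j / ((D : R) i i - (D : R) j j) else 0
  have hXper : R.of (fun i j => if j = i + m then x i j else 0) (fun i j h => if_neg (by omega))
      ∈ RZ n := by
    rw [mem_RZ_iff]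
    intro i j
    simp only [R.of_apply, x, hκ, hper, show j + 2 * (n : ℤ) = i + 2 * n + m ↔ j = i + m by omega]
  obtain ⟨X, hX⟩ : ∃ X : RZ n, ∀ i j, (X : R) i j = if j = i + m then x i j else 0 :=
    ⟨⟨_, hXper⟩, fun i j => rfl⟩
  have hX0 : ∀ i, (X : R) i i = 0 := fun i => by rw [hX, if_neg (by omega)]
  have hXd : dagger n X = -(X : R) := by
    refine R.ext fun i j _ => ?_
    rw [dagger_apply, R.neg_apply, hX, hX]
    by_cases hj : j = i + m
    · rw [if_pos (by omega), if_pos hj]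
      simp only [x, hκ', hDd', ← hDd i j, ne_comm (a := κ j)]
      split_ifs
      · rw [← neg_sub ((D : R) i i), div_neg, mul_neg, mul_div_assoc]
      · simp
    · rw [if_neg (by omega), if_neg hj, mul_zero, neg_zero]
  obtain ⟨g, h, H, hg, hh⟩ := exists_cayley X hX0 hXd
  have hdiag : ∀ i, ((g * D * h : RZ n) : R) i i = (D : R) i i := fun i => by
    simp [R.mul_apply_self, H.diag, H.diag_inv]
  refine ⟨g, h, H, hdiag, ?_⟩
  set D' : RZ n := g * D * h with hD'
  have hXl : ∀ (A : RZ n) (i j : ℤ), ((X * A : RZ n) : R) i j =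
      x i (i + m) * (A : R) (i + m) j := by
    intro A i j
    rw [Subalgebra.coe_mul, R.mul_apply]
    simp only [hX, ite_mul, zero_mul, Finset.sum_ite_eq', Finset.mem_Icc]
    split_ifs with h1
    · rfl
    · rw [R.apply_eq_zero _ (by omega), mul_zero]
  have hXr : ∀ (A : RZ n) (i j : ℤ), ((A * X : RZ n) : R) i j =
      (A : R) i (j - m) * x (j - m) j := by
    intro A i j
    rw [Subalgebra.coe_mul, R.mul_apply]
    simp only [hX, show ∀ l, (j = l + m ↔ l = j - m) by intro l; omega, mul_ite, mul_zero,
      Finset.sum_ite_eq', Finset.mem_Icc]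
    split_ifs with h1
    · rfl
    · rw [R.apply_eq_zero _ (by omega), zero_mul]
  have key : (1 - (2⁻¹ : ℂ) • X) * D' * (1 + (2⁻¹ : ℂ) • X)
      = (1 + (2⁻¹ : ℂ) • X) * D * (1 - (2⁻¹ : ℂ) • X) := by
    rw [hD', ← mul_assoc, ← mul_assoc, hg, mul_assoc _ h, hh]
  -- An exact identity free of inverses; on the m-th superdiagonal only the first-order term
  -- contributes, through the common diagonal of D and D'.
  have key2 : D' = D + (2⁻¹ : ℂ) • (X * (D' + D) - (D' + D) * X)
      + (4⁻¹ : ℂ) • (X * (D' - D) * X) := by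
    simp only [mul_add, add_mul, mul_sub, sub_mul, one_mul, mul_one, smul_mul_assoc,
      mul_smul_comm] at key
    simp only [mul_add, add_mul, mul_sub, sub_mul]
    rw [← sub_eq_zero] at key ⊢
    rw [← key]
    module
  have key3 : ∀ i j, (D' : R) i j = (D : R) i j
      + 2⁻¹ * (x i (i + m) * ((D' : R) (i + m) j + (D : R) (i + m) j)
        - ((D' : R) i (j - m) + (D : R) i (j - m)) * x (j - m) j)
      + 4⁻¹ * (x i (i + m) * ((D' : R) (i + m) (j - m)
        - (D : R) (i + m) (j - m)) * x (j - m) j) := by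
    intro i j
    have h1 := congrArg (fun A : RZ n => (A : R) i j) key2
    rw [← R.add_apply, ← R.sub_apply, ← R.add_apply]
    have h2 := hXl (D' + D) i j
    have h3 := hXr (D' + D) i j
    have h4 := hXr (X * (D' - D)) i j
    rw [hXl] at h4
    rw [h1]
    change (D : R) i j + 2⁻¹ * (((X * (D' + D) : RZ n) : R) i j - (((D' + D) * X : RZ n) : R) i j)
      + 4⁻¹ * ((X * (D' - D) * X : RZ n) : R) i j = _
    rw [h2, h3, h4]
    rfl
  intro i j hj hij
  have hz : ∀ A : R, j < i + m → A (i + m) j = 0 ∧ A i (j - m) = 0 := fun A hlt =>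
    ⟨R.apply_eq_zero _ (by omega), R.apply_eq_zero _ (by omega)⟩
  -- The quadratic term lies further out: here j - m ≤ i < i + m, the last inequality because m is
  -- positive.
  have hz' : ∀ A : R, A (i + m) (j - m) = 0 := fun A => R.apply_eq_zero _ (by omega)
  rw [key3, hz', hz']
  rcases lt_or_ge j (i + m) with hlt | hge
  · rw [(hz _ hlt).1, (hz _ hlt).1, (hz _ hlt).2, (hz _ hlt).2, hoff i j hlt hij]
    ring
  · obtain rfl : j = i + m := by omega
    rw [show i + (m : ℤ) - m = i by ring, hdiag, hdiag]
    simp only [x, if_pos hij]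
    have := sub_ne_zero.2 (hne i _ hij)
    field_simp
    ring

theorem exists_conj_block {n : ℕ} [NeZero n] (κ : ℤ → ℕ) (hκ : ∀ i, κ (i + 2 * n) = κ i)
    (hκ' : ∀ i, κ (2 * n - i + 1) = κ i) (D : RZ n) (hD : D ∈ RZa n .closed)
    (hne : ∀ i j, κ i ≠ κ j → (D : R) i i ≠ (D : R) j j) (m : ℕ) :
    ∃ g h, IsUni n g h ∧ (∀ i, ((g * D * h : RZ n) : R) i i = (D : R) i i) ∧
      ∀ i j : ℤ, j < i + m + 1 → κ i ≠ κ j → ((g * D * h : RZ n) : R) i j = 0 := by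
  induction m with
  | zero =>
    refine ⟨1, 1, IsUni.one n, fun i => by rw [one_mul, mul_one], fun i j hj hij => ?_⟩
    refine R.apply_eq_zero _ fun hle => hij ?_
    rw [show i = j by push_cast at hj; omega]
  | succ m ih =>
    obtain ⟨g, h, H, hdiag, hoff⟩ := ih
    obtain ⟨g', h', H', hdiag', hoff'⟩ := exists_conj_succ κ hκ hκ' (g * D * h) (H.conj_mem_RZa hD)
      (fun i j hij => by rw [hdiag, hdiag]; exact hne i j hij) (m + 1) m.succ_pos
      (fun i j hj => hoff i j (by push_cast at hj; omega))
    have heq : g' * g * D * (h * h') = g' * (g * D * h) * h' := by simp only [mul_assoc]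
    refine ⟨g' * g, h * h', H'.mul H, ?_, ?_⟩
    · intro i; rw [heq, hdiag', hdiag]
    · intro i j; rw [heq]; exact hoff' i j

/-- By induction on the distance to the diagonal, comparing the (i, j) entries of MD and DM leaves
only M_ij (D_jj - D_ii) = 0. -/
theorem block_of_comm {M D : R} (κ : ℤ → ℕ) (hMD : M * D = D * M) (hM : ∀ i, M i i = 0)
    (hne : ∀ i j, κ i ≠ κ j → D i i ≠ D j j) (m : ℤ)
    (hoff : ∀ i j : ℤ, j < i + m → κ i ≠ κ j → D i j = 0) :
    ∀ (k : ℕ) (i j : ℤ), j < i + k → j < i + m → κ i ≠ κ j → M i j = 0 := by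
  intro k
  induction k with
  | zero => intro i j h _ _; exact R.apply_eq_zero _ (by push_cast at h; omega)
  | succ k ih =>
    intro i j hk hm hij
    by_cases hle : i ≤ j
    swap
    · exact R.apply_eq_zero _ hle
    have h1 := congrArg (fun A : R => A i j) hMD
    simp only [R.mul_apply] at h1
    rw [Finset.sum_eq_single j, Finset.sum_eq_single i] at h1
    · have h2 : M i j * (D j j - D i i) = 0 := by rw [mul_sub, h1]; ring
      exact (mul_eq_zero.1 h2).resolve_right (sub_ne_zero.2 (hne j i hij.symm))
    · intro l hl hli
      rw [Finset.mem_Icc] at hl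
      by_cases h2 : κ i = κ l
      · rw [ih l j (by push_cast at hk; omega) (by omega) (h2 ▸ hij), mul_zero]
      · rw [hoff i l (by omega) h2, zero_mul]
    · intro h; exact absurd (Finset.mem_Icc.2 ⟨le_rfl, hle⟩) h
    · intro l hl hlj
      rw [Finset.mem_Icc] at hl
      by_cases h2 : κ i = κ l
      · rcases eq_or_ne l i with rfl | hli
        · rw [hM, zero_mul]
        · rw [hoff l j (by omega) (h2 ▸ hij), mul_zero]
      · rw [ih i l (by push_cast at hk; omega) (by omega) h2, zero_mul]
    · intro h; exact absurd (Finset.mem_Icc.2 ⟨hle, le_rfl⟩) h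

/-- A square-zero element of `𝓜^a_N`, with a separation hypothesis for the next superdiagonal of the
square of a lift, is conjugate to a block matrix. -/
theorem exists_conj_block_of_sq {n : ℕ} [NeZero n] {a : BType} (κ : Fin (2 * n) → ℕ)
    (hκ : ∀ p, κ p.rev = κ p) (M : RZ n) (hM : M ∈ RZa n a)
    (hU : ∀ p, umat n M p p = 0) (hsq : toMN n (M * M) = 0)
    (hne : ∀ p q, κ p ≠ κ q → lmat n (M * M) p p ≠ lmat n (M * M) q q) :
    ∃ g h, IsUni n g h ∧ (∀ p q, κ p ≠ κ q → umat n (g * M * h) p q = 0) ∧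
      ∀ p q, q < p → κ p ≠ κ q → lmat n (g * M * h) p q = 0 := by
  have hn : 0 < n := Nat.pos_of_ne_zero (NeZero.ne n)
  have hsq0 : ∀ i j : ℤ, j < i + 2 * n → ((M * M : RZ n) : R) i j = 0 :=
    apply_eq_zero_of_mem_idealS n _ (Ideal.Quotient.eq_zero_iff_mem.1 hsq)
  have hper := (mem_RZ_iff n _).1 (M * M).2
  -- D is the quotient of M² by S^N. Cancelling S^N shows that it commutes with M and is
  -- self-adjoint: the sign in M† = ±M disappears in the square.
  obtain ⟨D, hDapp⟩ : ∃ D : RZ n, ∀ i j, (D : R) i j = ((M * M : RZ n) : R) i (j + 2 * n) :=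
    ⟨⟨R.of (fun i j => ((M * M : RZ n) : R) i (j + 2 * n)) (fun i j h => hsq0 _ _ (by omega)),
      (mem_RZ_iff n _).2 fun i j => hper i (j + 2 * n)⟩, fun _ _ => rfl⟩
  have hDS : D * shiftN n = M * M := Subtype.ext (R.ext fun i j _ => by
    change ((D : R) * shift ^ (2 * n)) i j = _
    rw [mul_shift_pow_apply, hDapp]
    simp)
  have hcancel : ∀ A B : R, A * shift ^ (2 * n) = B * shift ^ (2 * n) → A = B := fun A B h =>
    R.ext fun i j _ => by
      have := congrArg (fun C : R => C i (j + (2 * n : ℕ))) h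
      simpa only [mul_shift_pow_apply, add_sub_cancel_right] using this
  have hMD : M * D = D * M := Subtype.ext (hcancel _ _ (by
    change ((M * D * shiftN n : RZ n) : R) = ((D * M * shiftN n : RZ n) : R)
    rw [mul_assoc M, hDS, mul_assoc D, ← shiftN_comm, ← mul_assoc D, hDS, mul_assoc]))
  have hDd : D ∈ RZa n .closed := by
    rw [mem_RZa_closed_iff]
    refine hcancel _ _ ?_
    have h1 : dagger n ((D * shiftN n : RZ n) : R) = ((D * shiftN n : RZ n) : R) := by
      rw [hDS, Subalgebra.coe_mul, dagger_mul, mem_RZa_iff.1 hM, smul_mul_smul_comm, eta_mul_self,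
        one_smul]
    have h2 : dagger n ((shiftN n * D : RZ n) : R) = dagger n D * shift ^ (2 * n) := by
      rw [Subalgebra.coe_mul, dagger_mul]
      exact congrArg _ (dagger_shift_pow n)
    rw [← h2, shiftN_comm, h1]
    rfl
  set κ' : ℤ → ℕ := fun i => κ (res n i) with hκ'
  have hresadd : ∀ i, κ' (i + 2 * n) = κ' i := fun i => by simp only [hκ', res_add]
  have hresmir : ∀ i, κ' (2 * n - i + 1) = κ' i := fun i => by
    obtain ⟨p, m, rfl⟩ := exists_ix n i
    simp only [hκ', ix_mirror, res_ix, hκ]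
  have hDdiag : ∀ p m, (D : R) (ix n p m) (ix n p m) = lmat n (M * M) p p := fun p m => by
    rw [hDapp, show ix n p m + 2 * n = ix n p (m + 1) by rw [ix_add, mul_one], RZ.apply_ix_add_one]
  have hne' : ∀ i j, κ' i ≠ κ' j → (D : R) i i ≠ (D : R) j j := by
    intro i j
    obtain ⟨p, m, rfl⟩ := exists_ix n i
    obtain ⟨q, k, rfl⟩ := exists_ix n j
    simp only [hκ', res_ix, hDdiag]
    exact hne p q
  -- Clearing the superdiagonals up to the N-th is enough, since only entries with j < i + N are
  -- seen in 𝓜_N.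
  obtain ⟨g, h, H, hdiag, hoff⟩ := exists_conj_block κ' hresadd hresmir D hDd hne' (2 * n)
  have hblock : ∀ i j : ℤ, j < i + 2 * n → κ' i ≠ κ' j → ((g * M * h : RZ n) : R) i j = 0 := by
    intro i j hj hij
    refine block_of_comm (M := ((g * M * h : RZ n) : R)) (D := ((g * D * h : RZ n) : R)) κ' ?_ ?_ ?_
      (2 * n) ?_ (2 * n) i j (by push_cast; omega) hj hij
    · have : g * M * h * (g * D * h) = g * D * h * (g * M * h) := by
        have e : ∀ A B, g * A * h * (g * B * h) = g * (A * B) * h := fun A B => by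
          calc g * A * h * (g * B * h) = g * A * (h * g) * B * h := by simp only [mul_assoc]
            _ = _ := by rw [H.inv_mul, mul_one, mul_assoc g]
        rw [e, e, hMD]
      exact congrArg Subtype.val this
    · intro i
      rw [Subalgebra.coe_mul, Subalgebra.coe_mul, R.mul_apply_self, R.mul_apply_self]
      obtain ⟨p, m, rfl⟩ := exists_ix n i
      rw [RZ.apply_ix M, hU, mul_zero, zero_mul]
    · intro i j hij
      rw [hdiag, hdiag]
      exact hne' i j hij
    · intro i j hj
      exact hoff i j (by push_cast; omega)
  refine ⟨g, h, H, fun p q hpq => ?_, fun p q hqp hpq => ?_⟩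
  · have := q.2
    exact hblock _ _ (by simp only [ix]; omega) (by simpa only [hκ', res_ix] using hpq)
  · rw [Fin.lt_def] at hqp
    exact hblock _ _ (by simp only [ix]; omega) (by simpa only [hκ', res_ix] using hpq)

/-! ### Link patterns -/

theorem incl_val {n : ℕ} (j : Fin n) : (incl n j : ℕ) = j := rfl

theorem exists_incl {n : ℕ} (p : Fin (2 * n)) : ∃ j, p = incl n j ∨ p = (incl n j).rev := by
  have hp := p.2
  by_cases h : (p : ℕ) < n
  · exact ⟨⟨p, h⟩, Or.inl rfl⟩
  · have hr : (p.rev : ℕ) < n := by rw [Fin.val_rev]; omega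
    exact ⟨⟨p.rev, hr⟩, Or.inr (by rw [← Fin.rev_eq_iff]; rfl)⟩

namespace LinkPattern

variable {n : ℕ} {a : BType}

theorem tilde_incl_some (π : LinkPattern n a) {j k : Fin n} (h : π.toFun j = some k) :
    π.tilde (incl n j) = incl n k := by
  have hj : ((incl n j : Fin (2 * n)) : ℕ) < n := j.2
  rw [tilde, dif_pos hj]
  have : (⟨(incl n j : ℕ), hj⟩ : Fin n) = j := rfl
  rw [this, h]

theorem tilde_incl_none (π : LinkPattern n a) {j : Fin n} (h : π.toFun j = none) :
    π.tilde (incl n j) = (incl n j).rev := by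
  have hj : ((incl n j : Fin (2 * n)) : ℕ) < n := j.2
  rw [tilde, dif_pos hj]
  have : (⟨(incl n j : ℕ), hj⟩ : Fin n) = j := rfl
  rw [this, h]

theorem tilde_rev_incl_some (π : LinkPattern n a) {j k : Fin n} (h : π.toFun j = some k) :
    π.tilde (incl n j).rev = (incl n k).rev := by
  have hj : ¬ (((incl n j).rev : Fin (2 * n)) : ℕ) < n := by
    rw [Fin.val_rev, incl_val]; omega
  rw [tilde, dif_neg hj]
  have : (⟨(incl n j : ℕ), j.2⟩ : Fin n) = j := rfl
  simp only [Fin.rev_rev]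
  rw [this, h]

theorem tilde_rev_incl_none (π : LinkPattern n a) {j : Fin n} (h : π.toFun j = none) :
    π.tilde (incl n j).rev = incl n j := by
  have hj : ¬ (((incl n j).rev : Fin (2 * n)) : ℕ) < n := by
    rw [Fin.val_rev, incl_val]; omega
  rw [tilde, dif_neg hj]
  have : (⟨(incl n j : ℕ), j.2⟩ : Fin n) = j := rfl
  simp only [Fin.rev_rev]
  rw [this, h]

theorem tilde_tilde (π : LinkPattern n a) (p : Fin (2 * n)) : π.tilde (π.tilde p) = p := by
  obtain ⟨j, rfl | rfl⟩ := exists_incl p <;> cases h : π.toFun j with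
  | none => simp only [π.tilde_incl_none h, π.tilde_rev_incl_none h]
  | some k =>
    have h' := π.symm j k h
    simp only [π.tilde_incl_some h, π.tilde_rev_incl_some h, π.tilde_incl_some h',
      π.tilde_rev_incl_some h']

theorem tilde_rev (π : LinkPattern n a) (p : Fin (2 * n)) : π.tilde p.rev = (π.tilde p).rev := by
  obtain ⟨j, rfl | rfl⟩ := exists_incl p <;> cases h : π.toFun j with
  | none => simp only [π.tilde_incl_none h, π.tilde_rev_incl_none h, Fin.rev_rev]
  | some k => simp only [π.tilde_incl_some h, π.tilde_rev_incl_some h, Fin.rev_rev]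

theorem eq_tilde_iff (π : LinkPattern n a) {p q : Fin (2 * n)} :
    p = π.tilde q ↔ q = π.tilde p :=
  ⟨fun h => by rw [h, tilde_tilde], fun h => by rw [h, tilde_tilde]⟩

theorem rev_eq_tilde_rev_iff (π : LinkPattern n a) {p q : Fin (2 * n)} :
    q.rev = π.tilde p.rev ↔ p = π.tilde q := by
  rw [tilde_rev, Fin.rev_inj, eq_tilde_iff]

theorem rev_ne (p : Fin (2 * n)) : p.rev ≠ p := by
  have := p.2
  rw [Ne, Fin.ext_iff, Fin.val_rev]
  omega

theorem tilde_ne_of_identified (π : LinkPattern n .identified) (p : Fin (2 * n)) :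
    π.tilde p ≠ p := by
  obtain ⟨j, rfl | rfl⟩ := exists_incl p <;> cases h : π.toFun j with
  | none =>
    simp only [π.tilde_incl_none h, π.tilde_rev_incl_none h]
    first | exact rev_ne _ | exact (rev_ne _).symm
  | some k =>
    have hk : k ≠ j := fun hk => π.admissible j (hk ▸ h)
    simp only [π.tilde_incl_some h, π.tilde_rev_incl_some h, ne_eq, Fin.rev_inj]
    intro h'
    have := congrArg Fin.val h'
    exact hk (Fin.ext this)

theorem tilde_lt_iff_of_closed (π : LinkPattern n .closed) (p : Fin (2 * n)) :
    (π.tilde p : ℕ) < n ↔ (p : ℕ) < n := by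
  obtain ⟨j, rfl | rfl⟩ := exists_incl p <;> cases h : π.toFun j with
  | none => exact absurd h (π.admissible.1 j)
  | some k =>
    simp only [π.tilde_incl_some h, π.tilde_rev_incl_some h, Fin.val_rev, incl_val]
    omega

/-- There is at most one unpaired point in {1, …, n}. This is why the unpaired indices can all share
the label 0. -/
theorem eq_or_eq_rev_of_fixed (π : LinkPattern n a) {p q : Fin (2 * n)} (hp : π.tilde p = p)
    (hq : π.tilde q = q) : q = p ∨ q = p.rev := by
  cases a with
  | identified => exact absurd hp (π.tilde_ne_of_identified p)
  | closed =>
    have hcard := π.admissible.2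
    have key : ∀ r, π.tilde r = r → ∃ j, π.toFun j = some j ∧
        (r = incl n j ∨ r = (incl n j).rev) := by
      intro r hr
      obtain ⟨j, hj⟩ := exists_incl r
      refine ⟨j, ?_, hj⟩
      cases h : π.toFun j with
      | none => exact absurd h (π.admissible.1 j)
      | some k =>
        rcases hj with rfl | rfl
        · rw [π.tilde_incl_some h, Fin.ext_iff, incl_val, incl_val] at hr
          rw [Fin.ext hr]
        · rw [π.tilde_rev_incl_some h, Fin.rev_inj, Fin.ext_iff, incl_val, incl_val] at hr
          rw [Fin.ext hr]
    obtain ⟨j, hj, hj'⟩ := key p hp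
    obtain ⟨k, hk, hk'⟩ := key q hq
    have hjk : j = k := Finset.card_le_one.1
      (show (Finset.univ.filter fun j => π.toFun j = some j).card ≤ 1 by rw [hcard]; omega)
      j (by simpa using hj) k (by simpa using hk)
    subst hjk
    rcases hj' with rfl | rfl <;> rcases hk' with rfl | rfl <;> simp

/-- A label of the orbits of `π̃` and the reflection, which is `0` on the unpaired points only. -/
def label (π : LinkPattern n a) (p : Fin (2 * n)) : ℕ :=
  if π.tilde p = p then 0
  else min (min (p : ℕ) (π.tilde p)) (min (p.rev : ℕ) (π.tilde p).rev) + 1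

theorem label_rev (π : LinkPattern n a) (p : Fin (2 * n)) : π.label p.rev = π.label p := by
  simp only [label, tilde_rev, Fin.rev_inj, Fin.rev_rev]
  rw [min_comm (min (p.rev : ℕ) _)]

theorem label_tilde (π : LinkPattern n a) (p : Fin (2 * n)) : π.label (π.tilde p) = π.label p := by
  simp only [label, tilde_tilde, eq_comm (a := p)]
  rw [min_comm (π.tilde p : ℕ), min_comm ((π.tilde p).rev : ℕ)]

/-- A nonzero label is one more than the least element of the orbit, so it determines the orbit; the
label 0 belongs to the single orbit of unpaired indices. -/
theorem eq_of_label_eq (π : LinkPattern n a) {p q : Fin (2 * n)} (h : π.label p = π.label q) :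
    q = p ∨ q = π.tilde p ∨ q = p.rev ∨ q = (π.tilde p).rev := by
  have key : ∀ p, π.tilde p ≠ p → ∃ r : Fin (2 * n), π.label p = r + 1 ∧
      (r = p ∨ r = π.tilde p ∨ r = p.rev ∨ r = (π.tilde p).rev) := by
    intro p hp
    rw [label, if_neg hp]
    rcases min_choice (min (p : ℕ) (π.tilde p)) (min (p.rev : ℕ) (π.tilde p).rev) with h | h <;>
    rw [h]
    · rcases min_choice (p : ℕ) (π.tilde p) with h | h <;> rw [h]
      · exact ⟨_, rfl, Or.inl rfl⟩
      · exact ⟨_, rfl, Or.inr (Or.inl rfl)⟩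
    · rcases min_choice (p.rev : ℕ) (π.tilde p).rev with h | h <;> rw [h]
      · exact ⟨_, rfl, Or.inr (Or.inr (Or.inl rfl))⟩
      · exact ⟨_, rfl, Or.inr (Or.inr (Or.inr rfl))⟩
  by_cases hp : π.tilde p = p
  · by_cases hq : π.tilde q = q
    · rcases π.eq_or_eq_rev_of_fixed hp hq with h | h <;> simp [h]
    · obtain ⟨r, hr, -⟩ := key q hq
      rw [hr, label, if_pos hp] at h
      omega
  · by_cases hq : π.tilde q = q
    · obtain ⟨r, hr, -⟩ := key p hp
      rw [hr, label, if_pos hq] at h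
      omega
    · obtain ⟨r, hr, h1⟩ := key p hp
      obtain ⟨s, hs, h2⟩ := key q hq
      obtain rfl : r = s := Fin.ext (by omega)
      have h3 : q = r ∨ q = π.tilde r ∨ q = r.rev ∨ q = (π.tilde r).rev := by
        rcases h2 with rfl | rfl | rfl | rfl <;> simp [tilde_rev, tilde_tilde]
      rcases h1 with rfl | rfl | rfl | rfl <;>
        (try simp only [tilde_rev, tilde_tilde, Fin.rev_rev] at h3) <;> tauto

/-! ### The matrices of a link pattern -/

theorem sign_mul_self (p q : Fin (2 * n)) : sign n a p q * sign n a p q = 1 := by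
  cases a <;> simp only [sign] <;> split_ifs <;> norm_num

theorem sign_of_closed (π : LinkPattern n .closed) {p q : Fin (2 * n)} (h : p = π.tilde q) :
    sign n .closed p q = 1 := by
  have := π.tilde_lt_iff_of_closed q
  rw [← h] at this
  rw [sign, if_neg]
  omega

theorem sign_comm (π : LinkPattern n a) {p q : Fin (2 * n)} (h : p = π.tilde q) :
    sign n a p q = sign n a q p := by
  cases a with
  | identified => simp only [sign, and_comm]
  | closed => rw [π.sign_of_closed h, π.sign_of_closed (π.eq_tilde_iff.1 h)]

theorem sgn_of_closed (π : LinkPattern n .closed) (p : Fin (2 * n)) :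
    sgn n (π.tilde p) = sgn n p := by
  simp only [sgn, π.tilde_lt_iff_of_closed]

theorem sign_rev (π : LinkPattern n a) {p q : Fin (2 * n)} (h : p = π.tilde q) :
    sgn n p * sgn n q * sign n a q.rev p.rev = eta a * sign n a p q := by
  cases a with
  | identified =>
    have h1 := p.2
    have h2 := q.2
    simp only [sign, eta, sgn, Fin.val_rev]
    split_ifs <;> first | omega | norm_num
  | closed =>
    rw [π.sign_of_closed h, π.sign_of_closed (p := q.rev) (q := p.rev)
      (by rw [h, tilde_rev, tilde_tilde]), h, sgn_of_closed, sgn_mul_self, eta]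

/-- For closed boundaries π̃ preserves each half, so neither the sign -1 nor the excluded
antidiagonal is ever met where p = π̃ q. One formula then serves both types. -/
theorem upperMatrix_apply (π : LinkPattern n a) (p q : Fin (2 * n)) :
    π.upperMatrix p q = if p < q ∧ p = π.tilde q then sign n a p q else 0 := by
  by_cases hpq : q ≤ p
  · cases a <;> simp [upperMatrix, hpq, not_lt.2 hpq]
  by_cases h : p = π.tilde q
  swap
  · cases a <;> simp [upperMatrix, h]
  rw [if_pos ⟨not_le.1 hpq, h⟩]
  cases a with
  | identified =>
    have : (p : ℕ) < q := not_le.1 hpq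
    simp only [upperMatrix, Matrix.of_apply, if_neg hpq, if_pos h, sign]
    split_ifs <;> first | rfl | omega
  | closed =>
    have h1 := π.tilde_lt_iff_of_closed q
    rw [← h] at h1
    have hq := q.2
    have hp := p.2
    rw [π.sign_of_closed h]
    simp only [upperMatrix, Matrix.of_apply, if_neg hpq, Fin.ext_iff, Fin.lt_def,
      Fin.val_rev]
    rw [Fin.le_def] at hpq
    rw [if_neg (by omega), if_neg (by omega), if_pos (by rw [← h])]

/-- The block of `π̲` in rows `1, …, N` and columns `N + 1, …, 2 N`. -/
def lowerMatrix (π : LinkPattern n a) : Matrix (Fin (2 * n)) (Fin (2 * n)) ℂ :=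
  .of fun p q => if q < p ∧ p = π.tilde q then sign n a p q else 0

theorem lowerMatrix_apply (π : LinkPattern n a) (p q : Fin (2 * n)) :
    π.lowerMatrix p q = if q < p ∧ p = π.tilde q then sign n a p q else 0 := rfl

theorem dag_upperMatrix (π : LinkPattern n a) : dag n π.upperMatrix = eta a • π.upperMatrix := by
  ext p q
  rw [dag_apply, Matrix.smul_apply, smul_eq_mul, upperMatrix_apply, upperMatrix_apply]
  by_cases h : p < q ∧ p = π.tilde q
  · rw [if_pos h, if_pos ⟨Fin.rev_lt_rev.2 h.1, π.rev_eq_tilde_rev_iff.2 h.2⟩, π.sign_rev h.2]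
  · rw [if_neg h, if_neg fun h' => h ⟨Fin.rev_lt_rev.1 h'.1, π.rev_eq_tilde_rev_iff.1 h'.2⟩,
      mul_zero, mul_zero]

theorem dag_lowerMatrix (π : LinkPattern n a) : dag n π.lowerMatrix = eta a • π.lowerMatrix := by
  ext p q
  rw [dag_apply, Matrix.smul_apply, smul_eq_mul, lowerMatrix_apply, lowerMatrix_apply]
  by_cases h : q < p ∧ p = π.tilde q
  · rw [if_pos h, if_pos ⟨Fin.rev_lt_rev.2 h.1, π.rev_eq_tilde_rev_iff.2 h.2⟩, π.sign_rev h.2]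
  · rw [if_neg h, if_neg fun h' => h ⟨Fin.rev_lt_rev.1 h'.1, π.rev_eq_tilde_rev_iff.1 h'.2⟩,
      mul_zero, mul_zero]

variable [NeZero n]

theorem matrix_apply_ix (π : LinkPattern n a) (p q : Fin (2 * n)) (m k : ℤ) :
    (π.matrix : R) (ix n p m) (ix n q k) =
      if (ix n p m < ix n q k ∧ ix n q k < ix n p (m + 1)) ∧ p = π.tilde q
      then sign n a p q else 0 := by
  change (if _ then _ else _ : ℂ) = _
  rw [res_ix, res_ix, ix_add, mul_one]
  simp only [and_assoc]

theorem umat_matrix (π : LinkPattern n a) : umat n π.matrix = π.upperMatrix := by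
  ext p q
  rw [umat_apply, matrix_apply_ix, upperMatrix_apply]
  simp only [ix_lt_ix]
  simp

theorem lmat_matrix (π : LinkPattern n a) : lmat n π.matrix = π.lowerMatrix := by
  ext p q
  rw [lmat_apply, matrix_apply_ix, lowerMatrix_apply]
  simp only [ix_lt_ix]
  simp

end LinkPattern

namespace LinkPattern

variable {n : ℕ} {a : BType}

/-! ### Reduced lifts -/

theorem triangular_mul {X Y : Matrix (Fin (2 * n)) (Fin (2 * n)) ℂ}
    (hX : ∀ p q, q < p → X p q = 0) (hY : ∀ p q, q < p → Y p q = 0) :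
    ∀ p q, q < p → (X * Y) p q = 0 := by
  intro p q hpq
  rw [Matrix.mul_apply]
  refine Finset.sum_eq_zero fun l _ => ?_
  rcases lt_or_ge l p with h | h
  · rw [hX p l h, zero_mul]
  · rw [hY l q (lt_of_lt_of_le hpq h), mul_zero]

theorem triangular_mul_apply_self {X Y : Matrix (Fin (2 * n)) (Fin (2 * n)) ℂ}
    (hX : ∀ p q, q < p → X p q = 0) (hY : ∀ p q, q < p → Y p q = 0) (p : Fin (2 * n)) :
    (X * Y) p p = X p p * Y p p := by
  rw [Matrix.mul_apply, Finset.sum_eq_single p]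
  · intro l _ hl
    rcases lt_or_gt_of_ne hl with h | h
    · rw [hX p l h, zero_mul]
    · rw [hY l p h, mul_zero]
  · simp

/-- `X` is block diagonal for the partition into the level sets of `label`. -/
def IsBlock (π : LinkPattern n a) (X : Matrix (Fin (2 * n)) (Fin (2 * n)) ℂ) : Prop :=
  ∀ p q, π.label p ≠ π.label q → X p q = 0

/-- The strictly lower triangular part of `X` is block diagonal. -/
def IsLowerBlock (π : LinkPattern n a) (X : Matrix (Fin (2 * n)) (Fin (2 * n)) ℂ) : Prop :=
  ∀ p q, q < p → π.label p ≠ π.label q → X p q = 0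

theorem IsBlock.mul {π : LinkPattern n a} {X Y : Matrix (Fin (2 * n)) (Fin (2 * n)) ℂ}
    (hX : π.IsBlock X) (hY : π.IsBlock Y) : π.IsBlock (X * Y) := by
  intro p q hpq
  rw [Matrix.mul_apply]
  refine Finset.sum_eq_zero fun l _ => ?_
  by_cases h : π.label p = π.label l
  · rw [hY l q (h ▸ hpq), mul_zero]
  · rw [hX p l h, zero_mul]

theorem IsBlock.mul_lower {π : LinkPattern n a} {X Y : Matrix (Fin (2 * n)) (Fin (2 * n)) ℂ}
    (hX : π.IsBlock X) (hX' : ∀ p q, q < p → X p q = 0) (hY : π.IsLowerBlock Y) :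
    π.IsLowerBlock (X * Y) := by
  intro p q hlt hpq
  rw [Matrix.mul_apply]
  refine Finset.sum_eq_zero fun l _ => ?_
  rcases lt_or_ge l p with h' | h'
  · rw [hX' p l h', zero_mul]
  · by_cases h : π.label p = π.label l
    · rw [hY l q (lt_of_lt_of_le hlt h') (h ▸ hpq), mul_zero]
    · rw [hX p l h, zero_mul]

theorem IsLowerBlock.mul_block {π : LinkPattern n a} {X Y : Matrix (Fin (2 * n)) (Fin (2 * n)) ℂ}
    (hY : π.IsLowerBlock Y) (hX : π.IsBlock X) (hX' : ∀ p q, q < p → X p q = 0) :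
    π.IsLowerBlock (Y * X) := by
  intro p q hlt hpq
  rw [Matrix.mul_apply]
  refine Finset.sum_eq_zero fun l _ => ?_
  rcases lt_or_ge q l with h' | h'
  · rw [hX' l q h', mul_zero]
  · by_cases h : π.label p = π.label l
    · rw [hX l q (h ▸ hpq), mul_zero]
    · rw [hY p l (lt_of_le_of_lt h' hlt) h, zero_mul]

theorem IsBlock.one (π : LinkPattern n a) : π.IsBlock 1 := fun _ _ h =>
  Matrix.one_apply_ne fun h' => h (h' ▸ rfl)

theorem upperMatrix_of_le (π : LinkPattern n a) {p q : Fin (2 * n)} (h : q ≤ p) :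
    π.upperMatrix p q = 0 := by
  rw [upperMatrix_apply, if_neg]
  exact fun h' => h.not_gt h'.1

/-! ### Lifts of elements of `F`, their symmetries and conjugates -/

variable {π : LinkPattern n a}

theorem umat_diag_of_conj {U A B : Matrix (Fin (2 * n)) (Fin (2 * n)) ℂ}
    (hBA : B * A = 1) (hA : ∀ p q, q < p → A p q = 0)
    (hB : ∀ p q, q < p → B p q = 0) (h : A * U * B = π.upperMatrix) (p : Fin (2 * n)) :
    U p p = 0 := by
  have hP : ∀ p q, q < p → π.upperMatrix p q = 0 := fun p q hpq => π.upperMatrix_of_le hpq.le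
  have hU : U = B * π.upperMatrix * A := by
    rw [← h, ← mul_assoc, ← mul_assoc, hBA, one_mul, mul_assoc, hBA, mul_one]
  rw [hU, triangular_mul_apply_self (triangular_mul hB hP) hA, triangular_mul_apply_self hB hP,
    π.upperMatrix_of_le le_rfl, mul_zero, zero_mul]

/-- `M` is a lift of an element of `F_π`. -/
structure IsLift (π : LinkPattern n a) (M : RZ n) : Prop where
  mem : M ∈ RZa n a
  sq : toMN n (M * M) = 0
  conj : ∃ A B, A * B = 1 ∧ B * A = 1 ∧ (∀ p q, q < p → A p q = 0) ∧ (∀ p q, q < p → B p q = 0) ∧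
    dag n A = B ∧ A * umat n M * B = π.upperMatrix

/-- `M` is a lift of an element of `F_π` that is block diagonal for the orbits of `π̃` and the
reflection. -/
structure IsReduced (π : LinkPattern n a) (M : RZ n) : Prop extends π.IsLift M where
  ublock : π.IsBlock (umat n M)
  lblock : π.IsLowerBlock (lmat n M)

variable {M : RZ n}

namespace IsLift

theorem umat_of_le (H : π.IsLift M) {p q : Fin (2 * n)} (h : q ≤ p) : umat n M p q = 0 := by
  obtain ⟨A, B, -, hBA, hA, hB, -, hP⟩ := H.conj
  rcases h.lt_or_eq with h | rfl
  · exact umat_apply_of_lt M h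
  · exact umat_diag_of_conj hBA hA hB hP q

variable [NeZero n]

theorem dag_umat (H : π.IsLift M) (p q : Fin (2 * n)) :
    sgn n p * sgn n q * umat n M q.rev p.rev = eta a * umat n M p q :=
  congrFun (congrFun (dag_umat_of_mem H.mem) p) q

theorem dag_lmat (H : π.IsLift M) (p q : Fin (2 * n)) :
    sgn n p * sgn n q * lmat n M q.rev p.rev = eta a * lmat n M p q :=
  congrFun (congrFun (dag_lmat_of_mem H.mem) p) q

theorem umat_sq (H : π.IsLift M) : umat n M * umat n M = 0 := by
  rw [← umat_mul]
  exact (toMN_eq_zero_iff.1 H.sq).1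

theorem lmat_sq (H : π.IsLift M) {p q : Fin (2 * n)} (h : q < p) :
    (umat n M * lmat n M + lmat n M * umat n M) p q = 0 := by
  rw [← lmat_mul]
  exact (toMN_eq_zero_iff.1 H.sq).2 p q h

/-- The adjoint fixes each antidiagonal position and multiplies its entry by ε_p ε_{p'} = -1. Hence
these entries vanish for closed boundaries and are unconstrained for identified ones. -/
theorem umat_rev (H : π.IsLift M) (p : Fin (2 * n)) :
    (1 + eta a) * umat n M p p.rev = 0 := by
  have := H.dag_umat p p.rev
  rw [Fin.rev_rev, sgn_rev] at this
  linear_combination -this - umat n M p p.rev * sgn_mul_self p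

theorem lmat_rev (H : π.IsLift M) (p : Fin (2 * n)) :
    (1 + eta a) * lmat n M p p.rev = 0 := by
  have := H.dag_lmat p p.rev
  rw [Fin.rev_rev, sgn_rev] at this
  linear_combination -this - lmat n M p p.rev * sgn_mul_self p

theorem conj_uni (H : π.IsLift M) {g h : RZ n} (hg : IsUni n g h) : π.IsLift (g * M * h) where
  mem := hg.conj_mem_RZa H.mem
  sq := by
    have : g * M * h * (g * M * h) = g * (M * M) * h := by
      calc g * M * h * (g * M * h) = g * M * (h * g) * M * h := by simp only [mul_assoc]
        _ = _ := by rw [hg.inv_mul, mul_one, mul_assoc g]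
    rw [this, map_mul, map_mul, H.sq, mul_zero, zero_mul]
  conj := by
    obtain ⟨A, B, hAB, hBA, hA, hB, hd, hP⟩ := H.conj
    have hgh : umat n g * umat n h = 1 := by rw [← umat_mul, hg.mul_inv, umat_one]
    have hhg : umat n h * umat n g = 1 := by rw [← umat_mul, hg.inv_mul, umat_one]
    refine ⟨A * umat n h, umat n g * B, ?_, ?_,
      triangular_mul hA fun p q => umat_apply_of_lt h,
      triangular_mul (fun p q => umat_apply_of_lt g) hB, ?_, ?_⟩
    · rw [mul_assoc, ← mul_assoc (umat n h), hhg, one_mul, hAB]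
    · rw [mul_assoc, ← mul_assoc B, hBA, one_mul, hgh]
    · rw [dag_mul, hd, dag_umat_of_dagger hg.symm.dagger_eq]
    · rw [umat_mul, umat_mul, ← hP]
      calc A * umat n h * (umat n g * umat n M * umat n h) * (umat n g * B)
          = A * (umat n h * umat n g) * umat n M * (umat n h * umat n g) * B := by
            simp only [mul_assoc]
        _ = _ := by rw [hhg, mul_one, mul_one]

end IsLift

namespace IsReduced

theorem eq_of_umat_ne (H : π.IsReduced M) {p q : Fin (2 * n)} (h : umat n M p q ≠ 0) :
    p < q ∧ (q = π.tilde p ∨ q = p.rev ∨ q = (π.tilde p).rev) := by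
  have hlt : p < q := lt_of_not_ge fun h' => h (H.umat_of_le h')
  have hl : π.label p = π.label q := by
    by_contra h'
    exact h (H.ublock p q h')
  exact ⟨hlt, (π.eq_of_label_eq hl).resolve_left hlt.ne'⟩

variable [NeZero n]

/-- Since X² = 0, the Cayley transform of X in the upper block is simply 1 + X, with inverse 1 - X.
-/
theorem exists_conj_upper (H : π.IsReduced M) (X : Matrix (Fin (2 * n)) (Fin (2 * n)) ℂ)
    (hX : X * X = 0) (hlt : ∀ p q, q ≤ p → X p q = 0) (hblock : π.IsBlock X) (hd : dag n X = -X) :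
    ∃ g h, IsUni n g h ∧ π.IsReduced (g * M * h) ∧
      umat n (g * M * h) = umat n M + X * umat n M - umat n M * X - X * umat n M * X := by
  have hlt' : ∀ p q, q < p → X p q = 0 := fun p q hpq => hlt p q hpq.le
  have huX : umat n (lift n X 0) = X := umat_lift _ _ hlt'
  have hlX : lmat n (lift n X 0) = 0 := lmat_lift _ _
  obtain ⟨g, h, hg, h1, -⟩ := exists_cayley (lift n X 0)
    (fun i => by
      obtain ⟨p, m, rfl⟩ := exists_ix n i
      rw [RZ.apply_ix, huX, hlt p p le_rfl])
    (by
      rw [← neg_one_smul ℂ (lift n X 0 : R)]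
      refine dagger_lift _ _ _ (by rw [hd, neg_one_smul]) ?_
      ext p q
      simp [dag_apply])
  have hinv : (1 + (2⁻¹ : ℂ) • X) * (1 - (2⁻¹ : ℂ) • X) = 1 := by
    simp [mul_sub, add_mul, hX]
  have hG : umat n g = 1 + X := by
    have h2 : (1 - (2⁻¹ : ℂ) • X) * umat n g = 1 + (2⁻¹ : ℂ) • X := by
      have := congrArg (umat n) h1
      rwa [umat_mul, map_sub, map_add, map_smul, umat_one, huX] at this
    calc umat n g = (1 + (2⁻¹ : ℂ) • X) * ((1 - (2⁻¹ : ℂ) • X) * umat n g) := by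
          rw [← mul_assoc, hinv, one_mul]
      _ = (1 + (2⁻¹ : ℂ) • X) * (1 + (2⁻¹ : ℂ) • X) := by rw [h2]
      _ = 1 + X := by
          simp only [mul_add, add_mul, one_mul, mul_one, smul_mul_smul_comm, hX, smul_zero]
          module
  have hG' : lmat n g = 0 := by
    have h2 : (1 - (2⁻¹ : ℂ) • X) * lmat n g = 0 := by
      have := congrArg (lmat n) h1
      rw [lmat_mul, map_sub, map_sub, map_add, map_smul, map_smul, umat_one, lmat_one, huX, hlX]
        at this
      simpa using this
    calc lmat n g = (1 + (2⁻¹ : ℂ) • X) * ((1 - (2⁻¹ : ℂ) • X) * lmat n g) := by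
          rw [← mul_assoc, hinv, one_mul]
      _ = 0 := by rw [h2, mul_zero]
  have hinv' : (1 - X) * umat n g = 1 := by
    rw [hG]
    simp [mul_add, sub_mul, hX]
  have hH : umat n h = 1 - X := by
    calc umat n h = (1 - X) * umat n g * umat n h := by rw [hinv', one_mul]
      _ = 1 - X := by rw [mul_assoc, ← umat_mul, hg.mul_inv, umat_one, mul_one]
  have hH' : lmat n h = 0 := by
    have h2 : umat n g * lmat n h = 0 := by
      have := congrArg (lmat n) hg.mul_inv
      rwa [lmat_mul, hG', zero_mul, add_zero, lmat_one] at this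
    calc lmat n h = (1 - X) * (umat n g * lmat n h) := by rw [← mul_assoc, hinv', one_mul]
      _ = 0 := by rw [h2, mul_zero]
  have hbG : π.IsBlock (umat n g) := by
    intro p q hpq
    rw [hG, Matrix.add_apply, hblock p q hpq, IsBlock.one π p q hpq, add_zero]
  have hbH : π.IsBlock (umat n h) := by
    intro p q hpq
    rw [hH, Matrix.sub_apply, hblock p q hpq, IsBlock.one π p q hpq, sub_zero]
  refine ⟨g, h, hg, ⟨H.toIsLift.conj_uni hg, ?_, ?_⟩, ?_⟩
  · rw [umat_mul, umat_mul]
    exact (hbG.mul H.ublock).mul hbH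
  · rw [lmat_mul, lmat_mul, hH', hG', mul_zero, zero_add, zero_mul, add_zero]
    exact (hbG.mul_lower (fun p q => umat_apply_of_lt g) H.lblock).mul_block hbH
      fun p q => umat_apply_of_lt h
  · rw [umat_mul, umat_mul, hG, hH]
    noncomm_ring

/-- An isometry with upper block 1 leaves the upper block of M alone and adds a commutator to the
next one. No triangularity of X is needed, because that block already lies above the diagonal of the
infinite matrix. -/
theorem exists_conj_lower (H : π.IsReduced M) (X : Matrix (Fin (2 * n)) (Fin (2 * n)) ℂ)
    (hblock : π.IsBlock X) (hd : dag n X = -X) :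
    ∃ g h, IsUni n g h ∧ π.IsReduced (g * M * h) ∧ umat n (g * M * h) = umat n M ∧
      lmat n (g * M * h) = lmat n M + X * umat n M - umat n M * X := by
  have huX : umat n (lift n 0 X) = 0 := umat_lift _ _ fun _ _ _ => rfl
  have hlX : lmat n (lift n 0 X) = X := lmat_lift _ _
  obtain ⟨g, h, hg, h1, -⟩ := exists_cayley (lift n 0 X)
    (fun i => by
      obtain ⟨p, m, rfl⟩ := exists_ix n i
      rw [RZ.apply_ix, huX]
      rfl)
    (by
      rw [← neg_one_smul ℂ (lift n 0 X : R)]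
      refine dagger_lift _ _ _ ?_ (by rw [hd, neg_one_smul])
      ext p q
      simp [dag_apply])
  have hG : umat n g = 1 := by
    have := congrArg (umat n) h1
    rw [umat_mul, map_sub, map_add, map_smul, umat_one, huX] at this
    simpa using this
  have hG' : lmat n g = X := by
    have := congrArg (lmat n) h1
    rw [lmat_mul, map_sub, map_sub, map_add, map_smul, map_smul, umat_one, lmat_one, huX, hlX, hG]
      at this
    simp only [smul_zero, sub_zero, one_mul, mul_one, zero_sub, zero_add] at this
    rw [← sub_eq_add_neg, sub_eq_iff_eq_add] at this
    rw [this]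
    module
  have hH : umat n h = 1 := by
    have := congrArg (umat n) hg.mul_inv
    rwa [umat_mul, hG, one_mul, umat_one] at this
  have hH' : lmat n h = -X := by
    have := congrArg (lmat n) hg.mul_inv
    rw [lmat_mul, hG, hG', hH, one_mul, mul_one, lmat_one] at this
    exact eq_neg_of_add_eq_zero_left this
  have hUeq : umat n (g * M * h) = umat n M := by
    rw [umat_mul, umat_mul, hG, hH, one_mul, mul_one]
  have hLeq : lmat n (g * M * h) = lmat n M + X * umat n M - umat n M * X := by
    rw [lmat_mul, lmat_mul, umat_mul, hG, hH, hG', hH']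
    noncomm_ring
  refine ⟨g, h, hg, ⟨H.toIsLift.conj_uni hg, ?_, ?_⟩, hUeq, hLeq⟩
  · rw [hUeq]; exact H.ublock
  · rw [hLeq]
    intro p q hlt hpq
    rw [Matrix.sub_apply, Matrix.add_apply, H.lblock p q hlt hpq, hblock.mul H.ublock p q hpq,
      H.ublock.mul hblock p q hpq]
    ring

end IsReduced
end LinkPattern

namespace LinkPattern

variable {n : ℕ} {a : BType}

/-! ### Elimination inside the blocks -/

theorem tilde_lt_iff (π : LinkPattern n a) {p : Fin (2 * n)} (h : π.tilde p ≠ p.rev) :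
    (π.tilde p : ℕ) < n ↔ (p : ℕ) < n := by
  obtain ⟨j, rfl | rfl⟩ := exists_incl p <;> cases hj : π.toFun j with
  | none =>
    refine absurd ?_ h
    simp only [π.tilde_incl_none hj, π.tilde_rev_incl_none hj, Fin.rev_rev]
  | some k =>
    simp only [π.tilde_incl_some hj, π.tilde_rev_incl_some hj, Fin.val_rev, incl_val]
    omega

/-- The matrix with entries `x p` at `(p, p.rev)` and `y p` at `(p, (π̃ p).rev)`. -/
def revMatrix (π : LinkPattern n a) (x y : Fin (2 * n) → ℂ) :
    Matrix (Fin (2 * n)) (Fin (2 * n)) ℂ :=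
  .of fun p q => (if q = p.rev then x p else 0) + if q = (π.tilde p).rev then y p else 0

theorem revMatrix_apply (π : LinkPattern n a) (x y : Fin (2 * n) → ℂ) (p q : Fin (2 * n)) :
    π.revMatrix x y p q
      = (if q = p.rev then x p else 0) + if q = (π.tilde p).rev then y p else 0 := rfl

theorem revMatrix_mul_apply (π : LinkPattern n a) (x y : Fin (2 * n) → ℂ)
    (A : Matrix (Fin (2 * n)) (Fin (2 * n)) ℂ) (p q : Fin (2 * n)) :
    (π.revMatrix x y * A) p q = x p * A p.rev q + y p * A (π.tilde p).rev q := by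
  simp only [Matrix.mul_apply, revMatrix_apply, add_mul, ite_mul, zero_mul, Finset.sum_add_distrib,
    Finset.sum_ite_eq', Finset.mem_univ, if_true]

theorem mul_revMatrix_apply (π : LinkPattern n a) (x y : Fin (2 * n) → ℂ)
    (A : Matrix (Fin (2 * n)) (Fin (2 * n)) ℂ) (p q : Fin (2 * n)) :
    (A * π.revMatrix x y) p q
      = A p q.rev * x q.rev + A p (π.tilde q).rev * y (π.tilde q).rev := by
  have h1 : ∀ l : Fin (2 * n), q = l.rev ↔ l = q.rev := fun l => by
    rw [eq_comm, Fin.rev_eq_iff]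
  have h2 : ∀ l : Fin (2 * n), π.tilde l = q.rev ↔ l = (π.tilde q).rev := fun l => by
    rw [eq_comm, eq_tilde_iff, tilde_rev]
  simp only [Matrix.mul_apply, revMatrix_apply, mul_add, mul_ite, mul_zero, Finset.sum_add_distrib,
    h1, h2, Finset.sum_ite_eq', Finset.mem_univ, if_true]

theorem revMatrix_isBlock (π : LinkPattern n a) (x y : Fin (2 * n) → ℂ) :
    π.IsBlock (π.revMatrix x y) := by
  intro p q hpq
  rw [revMatrix_apply, if_neg, if_neg, add_zero]
  · rintro rfl; exact hpq (by rw [label_rev, label_tilde])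
  · rintro rfl; exact hpq (by rw [label_rev])

/-- The positions (p, p') are skew for the adjoint by themselves, so x is free. The positions (p,
(π̃ p)') are exchanged in pairs, which forces y to be constant on chords with both ends in the same
half. -/
theorem dag_revMatrix (π : LinkPattern n a) (x y : Fin (2 * n) → ℂ)
    (hy : ∀ p, y (π.tilde p) = y p) (hy' : ∀ p, y p ≠ 0 → sgn n (π.tilde p) = sgn n p) :
    dag n (π.revMatrix x y) = -π.revMatrix x y := by
  ext p q
  rw [dag_apply, Matrix.neg_apply, revMatrix_apply, revMatrix_apply]
  have h1 : p.rev = q.rev.rev ↔ q = p.rev := by rw [Fin.rev_rev, eq_comm]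
  have h2 : p.rev = (π.tilde q.rev).rev ↔ q = (π.tilde p).rev := by
    rw [Fin.rev_inj, π.eq_tilde_iff, Fin.rev_eq_iff]
  simp only [h1, h2]
  have e1 : sgn n p * sgn n q * (if q = p.rev then x q.rev else 0)
      = -(if q = p.rev then x p else 0) := by
    split_ifs with h
    · subst h
      rw [Fin.rev_rev, sgn_rev]
      linear_combination -x p * sgn_mul_self p
    · simp
  have e2 : sgn n p * sgn n q * (if q = (π.tilde p).rev then y q.rev else 0)
      = -(if q = (π.tilde p).rev then y p else 0) := by
    split_ifs with h
    · subst h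
      rw [Fin.rev_rev, hy, sgn_rev]
      by_cases h0 : y p = 0
      · simp [h0]
      · rw [hy' p h0]
        linear_combination -y p * sgn_mul_self p
    · simp
  rw [mul_add, e1, e2]
  ring

/-- `p` is the left end of a chord in the left half. -/
def IsLeft (π : LinkPattern n a) (p : Fin (2 * n)) : Prop := p < π.tilde p ∧ (π.tilde p : ℕ) < n

variable {π : LinkPattern n a}

theorem IsLeft.lt {p : Fin (2 * n)} (hp : π.IsLeft p) : (p : ℕ) < n :=
  lt_trans (Fin.lt_def.1 hp.1) hp.2

variable {M : RZ n}

namespace IsReduced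

/-- In a reduced matrix the column of π̃ p can be nonzero only in row p. A zero entry would kill the
whole column, contradicting triangular conjugacy to π_<, which has a nonzero entry at that place. -/
theorem umat_ne_zero (H : π.IsReduced M) {p : Fin (2 * n)} (hp : π.IsLeft p) :
    umat n M p (π.tilde p) ≠ 0 := by
  intro h0
  have hlt := hp.1
  have hn := hp.2
  have hcol : ∀ l, umat n M l (π.tilde p) = 0 := by
    intro l
    by_contra h
    obtain ⟨h1, h2⟩ := H.eq_of_umat_ne h
    rw [Fin.lt_def] at h1
    rcases h2 with h2 | h2 | h2
    · rw [← π.tilde_tilde l, ← h2, tilde_tilde] at h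
      exact h h0
    · have := congrArg Fin.val h2
      rw [Fin.val_rev] at this
      omega
    · have h3 : l = p.rev := by
        rw [← Fin.rev_rev (π.tilde p), Fin.rev_inj, ← tilde_rev] at h2
        rw [← π.tilde_tilde l, ← h2, tilde_tilde]
      rw [h3, Fin.val_rev] at h1
      omega
  obtain ⟨A, B, hAB, hBA, hA, hB, -, hP⟩ := H.conj
  have hPA : π.upperMatrix * A = A * umat n M := by
    rw [← hP, mul_assoc, hBA, mul_one]
  have h1 := congrFun (congrFun hPA p) (π.tilde p)
  rw [Matrix.mul_apply, Matrix.mul_apply, Finset.sum_eq_single (π.tilde p), upperMatrix_apply,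
    if_pos ⟨hlt, (π.tilde_tilde p).symm⟩] at h1
  · rw [Finset.sum_eq_zero (s := Finset.univ) fun l _ => by rw [hcol, mul_zero]] at h1
    have h2 := triangular_mul_apply_self hA hB (π.tilde p)
    rw [hAB, Matrix.one_apply_eq] at h2
    rcases mul_eq_zero.1 h1 with h | h
    · have := sign_mul_self (a := a) p (π.tilde p)
      rw [h] at this
      simp at this
    · rw [h, zero_mul] at h2
      exact one_ne_zero h2
  · intro l _ hl
    rw [upperMatrix_apply, if_neg, zero_mul]
    exact fun h => hl (π.eq_tilde_iff.1 h.2)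
  · simp

variable [NeZero n]

theorem umat_rev_rev (H : π.IsReduced M) {p : Fin (2 * n)} (hp : π.IsLeft p) :
    umat n M (π.tilde p).rev p.rev = eta a * umat n M p (π.tilde p) := by
  have h1 := H.dag_umat p (π.tilde p)
  have h2 : sgn n p = 1 := if_pos hp.lt
  have h3 : sgn n (π.tilde p) = 1 := if_pos hp.2
  rwa [h2, h3, one_mul, one_mul] at h1

theorem umat_rev_rev_ne_zero (H : π.IsReduced M) {p : Fin (2 * n)} (hp : π.IsLeft p) :
    umat n M (π.tilde p).rev p.rev ≠ 0 := by
  rw [H.umat_rev_rev hp]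
  refine mul_ne_zero (fun h => ?_) (H.umat_ne_zero hp)
  have := eta_mul_self a
  rw [h] at this
  simp at this

/-- With p < q < q' < p' the block, the (p, q') entry of U² reduces to the pivot (p, q) times the
entry (q, q'). -/
theorem umat_inner (H : π.IsReduced M) {p : Fin (2 * n)} (hp : π.IsLeft p) :
    umat n M (π.tilde p) (π.tilde p).rev = 0 := by
  have h1 := congrFun (congrFun H.umat_sq p) (π.tilde p).rev
  rw [Matrix.mul_apply, Finset.sum_eq_single (π.tilde p)] at h1
  · exact (mul_eq_zero.1 h1).resolve_left (H.umat_ne_zero hp)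
  · intro l _ hl
    by_contra h
    obtain ⟨h2, h3⟩ := H.eq_of_umat_ne (left_ne_zero_of_mul h)
    rcases h3 with h3 | h3 | h3
    · exact hl h3
    · refine right_ne_zero_of_mul h (H.umat_of_le ?_)
      rw [h3, Fin.rev_le_rev]
      exact hp.1.le
    · exact right_ne_zero_of_mul h (H.umat_of_le h3.ge)
  · simp

theorem exists_conj_kill_outer (H : π.IsReduced M) :
    ∃ g h, IsUni n g h ∧ π.IsReduced (g * M * h) ∧
      ∀ p, π.IsLeft p → umat n (g * M * h) p (π.tilde p).rev = 0 := by
  classical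
  -- X is placed at (q, q'), with q the right end of a left chord; the term -UX then cancels the
  -- entry (p, q') against the pivot (p, q).
  let x : Fin (2 * n) → ℂ := fun q => if π.tilde q < q ∧ (q : ℕ) < n then
    umat n M (π.tilde q) q.rev / umat n M (π.tilde q) q else 0
  have hx : ∀ q, x q ≠ 0 → (q : ℕ) < n := fun q hq => by
    by_contra h
    exact hq (if_neg fun h' => h h'.2)
  obtain ⟨g, h, hg, H', hU⟩ := H.exists_conj_upper (π.revMatrix x 0)
    (by
      ext p q
      rw [revMatrix_mul_apply]
      by_cases h0 : x p = 0
      · simp [h0]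
      · have h1 : x p.rev = 0 := by
          by_contra h1
          have h2 := hx _ h0
          have h3 := hx _ h1
          rw [Fin.val_rev] at h3
          omega
        simp [revMatrix_apply, h1])
    (by
      intro p q hqp
      rw [revMatrix_apply]
      by_cases h0 : x p = 0
      · simp [h0]
      · have h2 := hx _ h0
        rw [if_neg]
        · simp
        · rintro rfl
          rw [Fin.le_def, Fin.val_rev] at hqp
          omega)
    (π.revMatrix_isBlock _ _) (π.dag_revMatrix _ _ (fun _ => rfl) fun p h => absurd rfl h)
  refine ⟨g, h, hg, H', fun p hp => ?_⟩
  have hxp : x p = 0 := if_neg fun h' => h'.1.not_gt hp.1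
  have hxt : x (π.tilde p) = umat n M p (π.tilde p).rev / umat n M p (π.tilde p) := by
    have : π.tilde (π.tilde p) < π.tilde p ∧ (π.tilde p : ℕ) < n := by
      rw [tilde_tilde]; exact hp
    simp only [x, if_pos this, tilde_tilde]
  rw [hU, Matrix.sub_apply, Matrix.sub_apply, Matrix.add_apply, mul_assoc, revMatrix_mul_apply,
    revMatrix_mul_apply, mul_revMatrix_apply, hxp, Fin.rev_rev, hxt]
  have := H.umat_ne_zero hp
  simp only [Pi.zero_apply]
  field_simp
  ring

theorem exists_conj_kill_upper (H : π.IsReduced M)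
    (h0 : ∀ p, π.IsLeft p → umat n M p (π.tilde p).rev = 0) :
    ∃ g h, IsUni n g h ∧ π.IsReduced (g * M * h) ∧
      ∀ p, π.IsLeft p → umat n (g * M * h) p (π.tilde p).rev = 0 ∧
        umat n (g * M * h) p p.rev = 0 := by
  classical
  -- With X equal to y at (p, q') and (q, p'), the (p, p') entry changes by (η - 1) y u, where u is
  -- the pivot. For η = -1 this explains the factor 2; for η = 1 the entry is already zero.
  let f : Fin (2 * n) → ℂ := fun p => umat n M p p.rev / (2 * umat n M p (π.tilde p))
  let y : Fin (2 * n) → ℂ := fun p => if π.IsLeft p then f p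
    else if π.IsLeft (π.tilde p) then f (π.tilde p) else 0
  have hleft : ∀ {p}, π.IsLeft p → ¬ π.IsLeft (π.tilde p) := fun hp hp' => by
    have := hp'.1
    rw [tilde_tilde] at this
    exact this.not_gt hp.1
  have hy : ∀ p, y p ≠ 0 → (p : ℕ) < n ∧ (π.tilde p : ℕ) < n := fun p hp => by
    by_cases h1 : π.IsLeft p
    · exact ⟨h1.lt, h1.2⟩
    by_cases h2 : π.IsLeft (π.tilde p)
    · have h3 := h2.1
      have h4 := h2.2
      rw [tilde_tilde] at h3 h4
      exact ⟨h4, lt_trans h3 h4⟩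
    · exact absurd (by simp only [y, if_neg h1, if_neg h2]) hp
  have hyt : ∀ p, y (π.tilde p) = y p := fun p => by
    by_cases h1 : π.IsLeft p
    · simp only [y, if_pos h1, if_neg (hleft h1), tilde_tilde]
    · by_cases h2 : π.IsLeft (π.tilde p)
      · simp only [y, if_neg h1, if_pos h2]
      · simp only [y, if_neg h1, if_neg h2, tilde_tilde]
  obtain ⟨g, h, hg, H', hU⟩ := H.exists_conj_upper (π.revMatrix 0 y)
    (by
      ext p q
      rw [revMatrix_mul_apply]
      by_cases h0 : y p = 0
      · simp [h0]
      · have h1 : y (π.tilde p).rev = 0 := by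
          by_contra h1
          have h2 := (hy _ h0).2
          have h3 := (hy _ h1).1
          rw [Fin.val_rev] at h3
          omega
        simp [revMatrix_apply, h1])
    (by
      intro p q hqp
      rw [revMatrix_apply]
      by_cases h0 : y p = 0
      · simp [h0]
      · have h2 := hy _ h0
        rw [if_neg (c := q = (π.tilde p).rev)]
        · simp
        · rintro rfl
          rw [Fin.le_def, Fin.val_rev] at hqp
          omega)
    (π.revMatrix_isBlock _ _) (π.dag_revMatrix _ _ hyt fun p h => by
      simp only [sgn, if_pos (hy p h).1, if_pos (hy p h).2])
  refine ⟨g, h, hg, H', fun p hp => ?_⟩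
  have hyp : y p = f p := if_pos hp
  have hlt := hp.1
  have hn := hp.2
  rw [Fin.lt_def] at hlt
  have hle : p ≤ (π.tilde p).rev := by rw [Fin.le_def, Fin.val_rev]; omega
  have hle' : π.tilde p ≤ (π.tilde p).rev := by rw [Fin.le_def, Fin.val_rev]; omega
  simp only [hU, Matrix.sub_apply, Matrix.add_apply, mul_assoc (π.revMatrix 0 y),
    revMatrix_mul_apply, mul_revMatrix_apply, tilde_rev, Fin.rev_rev, tilde_tilde, hyt, hyp,
    Pi.zero_apply, h0 p hp, H.umat_of_le le_rfl, H.umat_of_le hle, H.umat_of_le hle',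
    H.umat_rev_rev hp]
  refine ⟨by ring, ?_⟩
  have h1 := H.umat_ne_zero hp
  have h2 : f p * umat n M p (π.tilde p) = umat n M p p.rev / 2 := by
    simp only [f]
    field_simp
  linear_combination (1 / 2) * H.umat_rev p + (eta a - 1) * h2

theorem exists_conj_kill_lower (H : π.IsReduced M) :
    ∃ g h, IsUni n g h ∧ π.IsReduced (g * M * h) ∧ umat n (g * M * h) = umat n M ∧
      ∀ p, π.IsLeft p → lmat n (g * M * h) (π.tilde p).rev p = 0 ∧
        lmat n (g * M * h) (π.tilde p).rev (π.tilde p) = 0 := by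
  classical
  -- x sits at (p', p) and kills (q', p) through the pivot (q', p'). y sits at (q', p) and (p', q)
  -- and kills (q', q), with the same factor 2 as in the upper elimination.
  let x : Fin (2 * n) → ℂ := fun q => if π.IsLeft q.rev then
    lmat n M (π.tilde q) q.rev / umat n M (π.tilde q) q else 0
  let f : Fin (2 * n) → ℂ := fun p => lmat n M p p.rev / (2 * umat n M p (π.tilde p))
  let y : Fin (2 * n) → ℂ := fun p => if π.IsLeft p.rev then f (π.tilde p)
    else if π.IsLeft (π.tilde p).rev then f p else 0
  have hleft : ∀ {p}, π.IsLeft p → ¬ π.IsLeft (π.tilde p) := fun hp hp' => by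
    have := hp'.1
    rw [tilde_tilde] at this
    exact this.not_gt hp.1
  have hy : ∀ p, y p ≠ 0 → ¬ (p : ℕ) < n ∧ ¬ (π.tilde p : ℕ) < n := fun p hp => by
    by_cases h1 : π.IsLeft p.rev
    · have h3 := h1.lt
      have h4 := h1.2
      rw [tilde_rev, Fin.val_rev] at h4
      rw [Fin.val_rev] at h3
      omega
    by_cases h2 : π.IsLeft (π.tilde p).rev
    · have h3 := h2.lt
      have h4 := h2.2
      rw [tilde_rev, tilde_tilde, Fin.val_rev] at h4
      rw [Fin.val_rev] at h3
      omega
    · exact absurd (by simp only [y, if_neg h1, if_neg h2]) hp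
  have hyt : ∀ p, y (π.tilde p) = y p := fun p => by
    by_cases h1 : π.IsLeft p.rev
    · have h2 : ¬ π.IsLeft (π.tilde p).rev := by rw [← tilde_rev]; exact hleft h1
      simp only [y, if_pos h1, if_neg h2, tilde_tilde]
    · by_cases h2 : π.IsLeft (π.tilde p).rev
      · simp only [y, if_neg h1, if_pos h2, tilde_tilde]
      · simp only [y, if_neg h1, if_neg h2, tilde_tilde]
  obtain ⟨g, h, hg, H', hU, hL⟩ := H.exists_conj_lower (π.revMatrix x y)
    (π.revMatrix_isBlock _ _) (π.dag_revMatrix _ _ hyt fun p h => by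
      simp only [sgn, if_neg (hy p h).1, if_neg (hy p h).2])
  refine ⟨g, h, hg, H', hU, fun p hp => ?_⟩
  have hxp : x p.rev = lmat n M (π.tilde p).rev p / umat n M (π.tilde p).rev p.rev := by
    simp only [x, Fin.rev_rev, if_pos hp, tilde_rev]
  have hxt : x (π.tilde p).rev = 0 := by
    simp only [x, Fin.rev_rev, if_neg (hleft hp)]
  have hyp : y p.rev = f (π.tilde p).rev := by
    simp only [y, Fin.rev_rev, if_pos hp, tilde_rev]
  have hyp' : y (π.tilde p).rev = f (π.tilde p).rev := by
      rw [← hyp, ← hyt, tilde_rev, tilde_tilde, ← hyt, tilde_rev]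
  have h1 := H.umat_ne_zero hp
  have h2 := H.umat_rev_rev_ne_zero hp
  constructor
  · simp only [hL, Matrix.sub_apply, Matrix.add_apply, revMatrix_mul_apply, mul_revMatrix_apply,
      tilde_rev, Fin.rev_rev, tilde_tilde, hxp, hxt, H.umat_of_le le_rfl]
    field_simp
    ring
  · simp only [hL, Matrix.sub_apply, Matrix.add_apply, revMatrix_mul_apply, mul_revMatrix_apply,
      tilde_rev, Fin.rev_rev, tilde_tilde, hxt, hyp, hyp']
    have h3 := H.lmat_rev (π.tilde p).rev
    have h4 : f (π.tilde p).rev * umat n M (π.tilde p).rev p.rev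
        = lmat n M (π.tilde p).rev (π.tilde p) / 2 := by
      simp only [f, tilde_rev, tilde_tilde, Fin.rev_rev]
      field_simp
    simp only [Fin.rev_rev] at h3
    linear_combination (1 / 2) * h3 + (eta a - 1) * h4
      - f (π.tilde p).rev * eta a * H.umat_rev_rev hp
      - f (π.tilde p).rev * umat n M p (π.tilde p) * eta_mul_self a

end IsReduced
end LinkPattern

/-! ### Zariski closures -/

theorem zariskiClosure_subset {V : Type*} [AddCommGroup V] [Module ℂ V] {s t : Set V}
    (h : s ⊆ zariskiClosure t) : zariskiClosure s ⊆ zariskiClosure t :=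
  fun _ hx p hp hpt => hx p hp fun _ hy => h hy p hp hpt

theorem exists_polynomial_line {V : Type*} [AddCommGroup V] [Module ℂ V] {p : V → ℂ}
    (hp : p ∈ Algebra.adjoin ℂ (Set.range fun f : Module.Dual ℂ V => (f : V → ℂ))) (x y : V) :
    ∃ q : Polynomial ℂ, ∀ c : ℂ, p (x + c • y) = q.eval c := by
  induction hp using Algebra.adjoin_induction with
  | mem p hp =>
    obtain ⟨f, rfl⟩ := hp
    refine ⟨Polynomial.C (f x) + Polynomial.X * Polynomial.C (f y), fun c => ?_⟩
    simp only [map_add, map_smul, smul_eq_mul, Polynomial.eval_add, Polynomial.eval_mul,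
      Polynomial.eval_C, Polynomial.eval_X]
  | algebraMap r => exact ⟨Polynomial.C r, fun c => by simp⟩
  | add p p' _ _ h h' =>
    obtain ⟨q, hq⟩ := h
    obtain ⟨q', hq'⟩ := h'
    exact ⟨q + q', fun c => by simp [hq, hq']⟩
  | mul p p' _ _ h h' =>
    obtain ⟨q, hq⟩ := h
    obtain ⟨q', hq'⟩ := h'
    exact ⟨q * q', fun c => by simp [hq, hq']⟩

/-- Restricted to the line, a polynomial function is a polynomial in c with infinitely many roots;
being zero, it vanishes also at c = 0. -/
theorem mem_zariskiClosure_of_line {V : Type*} [AddCommGroup V] [Module ℂ V] {s : Set V} (x y : V)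
    {t : Set ℂ} (ht : t.Finite) (h : ∀ c ∉ t, x + c • y ∈ s) : x ∈ zariskiClosure s := by
  intro p hp hps
  obtain ⟨q, hq⟩ := exists_polynomial_line hp x y
  have hq0 : q = 0 := by
    refine Polynomial.eq_zero_of_infinite_isRoot q (ht.infinite_compl.mono fun c hc => ?_)
    rw [Set.mem_ofPred_eq, Polynomial.IsRoot, ← hq]
    exact hps _ (h c hc)
  have := hq 0
  rwa [zero_smul, add_zero, hq0, Polynomial.eval_zero] at this

theorem mem_orbit_of_mem {n : ℕ} {s : Set (MN n)} {m : MN n} (hm : m ∈ s) : m ∈ orbit n s :=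
  mem_orbit_iff.2 ⟨1, 1, IsUni.one n, m, hm, by rw [map_one, one_mul, mul_one]⟩

theorem mem_orbit_of_conj {n : ℕ} [NeZero n] {s : Set (MN n)} {g h M : RZ n} (hg : IsUni n g h)
    (hm : toMN n (g * M * h) ∈ orbit n s) : toMN n M ∈ orbit n s := by
  obtain ⟨g', h', hg', x, hx, heq⟩ := mem_orbit_iff.1 hm
  refine mem_orbit_iff.2 ⟨h * g', h' * g, hg.symm.mul hg', x, hx, ?_⟩
  have h1 : M = h * (g * M * h) * g := by
    calc M = (h * g) * M * (h * g) := by rw [hg.inv_mul, one_mul, mul_one]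
      _ = _ := by simp only [mul_assoc]
  rw [h1, map_mul, map_mul, heq, map_mul, map_mul]
  simp only [mul_assoc]

namespace LinkPattern

/-! ### The family `π̲ t` -/

variable {n : ℕ} {a : BType} {π : LinkPattern n a} {M : RZ n}

theorem toMN_mem_MNa (hM : M ∈ RZa n a) : toMN n M ∈ MNa n a := Submodule.mem_map_of_mem hM

theorem eta_of_tilde_eq {p : Fin (2 * n)} (h : π.tilde p = p) : eta a = 1 := by
  cases a with
  | identified => exact absurd h (π.tilde_ne_of_identified p)
  | closed => rfl

variable [NeZero n]

theorem mem_family_of_support (hM : M ∈ RZa n a)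
    (hU : ∀ p q, umat n M p q ≠ 0 → p < q ∧ p = π.tilde q)
    (hL : ∀ p q, q < p → lmat n M p q ≠ 0 → p = π.tilde q) : toMN n M ∈ π.family := by
  -- Each column has one admissible position, in row π̃ q, in the upper or the lower block according
  -- to the order. The sign is its own inverse; if π̃ q = q the value is immaterial.
  let τ : Fin (2 * n) → ℂ := fun q =>
    sign n a (π.tilde q) q *
      if π.tilde q < q then umat n M (π.tilde q) q else lmat n M (π.tilde q) q
  have hτ : ∀ p q, q < p → Matrix.diagonal τ p q = 0 :=
      fun p q h => Matrix.diagonal_apply_ne _ h.ne'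
  refine ⟨toMN_mem_MNa hM, lift n (Matrix.diagonal τ) 0, ?_, ?_⟩
  · intro i j hij
    obtain ⟨p, m, rfl⟩ := exists_ix n i
    obtain ⟨q, k, rfl⟩ := exists_ix n j
    rw [lift_apply_ix]
    split_ifs with h1 h2
    · refine Matrix.diagonal_apply_ne _ fun hpq => hij ?_
      rw [h1, hpq]
    · rfl
    · rfl
    · rfl
  · rw [toMN_eq_iff, umat_mul, lmat_mul, umat_lift _ _ hτ, lmat_lift, umat_matrix, lmat_matrix,
      mul_zero, zero_add]
    constructor
    · ext p q
      rw [Matrix.mul_diagonal, upperMatrix_apply]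
      by_cases h : p < q ∧ p = π.tilde q
      · obtain ⟨h1, rfl⟩ := h
        rw [if_pos ⟨h1, rfl⟩]
        simp only [τ, if_pos h1]
        rw [← mul_assoc, sign_mul_self, one_mul]
      · rw [if_neg h, zero_mul]
        by_contra h'
        exact h (hU p q h')
    · intro p q hqp
      rw [Matrix.mul_diagonal, lowerMatrix_apply]
      by_cases h : p = π.tilde q
      · subst h
        rw [if_pos ⟨hqp, rfl⟩]
        simp only [τ, if_neg hqp.not_gt]
        rw [← mul_assoc, sign_mul_self, one_mul]
      · rw [if_neg fun h' => h h'.2, zero_mul]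
        by_contra h'
        exact h (hL p q hqp h')

theorem IsReduced.mem_family (H : π.IsReduced M)
    (hU : ∀ p, π.IsLeft p → umat n M p (π.tilde p).rev = 0 ∧ umat n M p p.rev = 0)
    (hL : ∀ p, π.IsLeft p → lmat n M (π.tilde p).rev p = 0 ∧
      lmat n M (π.tilde p).rev (π.tilde p) = 0) : toMN n M ∈ π.family := by
  have hsgn : ∀ p q : Fin (2 * n), sgn n p * sgn n q ≠ 0 := fun p q =>
    mul_ne_zero (fun h => by simpa [h] using sgn_mul_self p) fun h => by
      simpa [h] using sgn_mul_self q
  have hUouter : ∀ p, π.IsLeft p → umat n M (π.tilde p) p.rev = 0 := fun p hp => by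
    have h1 := H.dag_umat p (π.tilde p).rev
    rw [(hU p hp).1, mul_zero, Fin.rev_rev] at h1
    exact (mul_eq_zero.1 h1).resolve_left (hsgn _ _)
  have hLouter : ∀ p, π.IsLeft p → lmat n M p.rev (π.tilde p) = 0 := fun p hp => by
    have h1 := H.dag_lmat (π.tilde p).rev p
    rw [(hL p hp).1, mul_zero, Fin.rev_rev] at h1
    exact (mul_eq_zero.1 h1).resolve_left (hsgn _ _)
  -- In the (q', p) entry of the lower block of M², only the pivot (q', p') times the lower entry
  -- (p', p) survives; column p of the upper block is zero.
  have hLinner : ∀ p, π.IsLeft p → lmat n M p.rev p = 0 := fun p hp => by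
    have hlt := Fin.lt_def.1 hp.1
    have hn := hp.2
    have h1 := H.lmat_sq (p := (π.tilde p).rev) (q := p)
      (by rw [Fin.lt_def, Fin.val_rev]; omega)
    rw [Matrix.add_apply, Matrix.mul_apply, Matrix.mul_apply, Finset.sum_eq_single p.rev,
      Finset.sum_eq_zero (f := fun l => lmat n M _ l * umat n M l p), add_zero] at h1
    · exact (mul_eq_zero.1 h1).resolve_left (H.umat_rev_rev_ne_zero hp)
    · intro l _
      by_contra h
      obtain ⟨h2, h3⟩ := H.eq_of_umat_ne (right_ne_zero_of_mul h)
      rw [Fin.lt_def] at h2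
      rcases h3 with h3 | h3 | h3
      · rw [← π.tilde_tilde l, ← h3] at h2
        omega
      · rw [eq_comm, Fin.rev_eq_iff] at h3
        rw [h3, Fin.val_rev] at h2
        omega
      · rw [← tilde_rev, eq_tilde_iff, Fin.rev_eq_iff] at h3
        rw [h3, Fin.val_rev] at h2
        omega
    · intro l _ hl
      by_contra h
      obtain ⟨h2, h3⟩ := H.eq_of_umat_ne (left_ne_zero_of_mul h)
      rw [Fin.lt_def, Fin.val_rev] at h2
      simp only [tilde_rev, tilde_tilde, Fin.rev_rev] at h3
      rcases h3 with h3 | h3 | h3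
      · exact hl h3
      · rw [h3] at h2; omega
      · rw [h3] at h2; omega
    · simp
  have hfix : ∀ p, π.tilde p = p → umat n M p p.rev = 0 ∧ lmat n M p p.rev = 0 := fun p hp => by
    have h1 := H.umat_rev p
    have h2 := H.lmat_rev p
    rw [eta_of_tilde_eq hp] at h1 h2
    norm_num at h1 h2
    exact ⟨h1, h2⟩
  refine mem_family_of_support H.mem (fun p q hpq => ?_) fun p q hqp hpq => ?_
  · obtain ⟨hlt, h⟩ := H.eq_of_umat_ne hpq
    refine ⟨hlt, ?_⟩
    rw [eq_tilde_iff]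
    by_contra hne
    have h' := h.resolve_left hne
    by_cases hb : π.tilde p = p.rev
    · rw [hb, Fin.rev_rev, or_iff_left hlt.ne'] at h'
      exact hne (h'.trans hb.symm)
    by_cases hf : π.tilde p = p
    · rw [hf, or_self] at h'
      subst h'
      exact hpq (hfix p hf).1
    have hhalf := π.tilde_lt_iff hb
    have hp : (p : ℕ) < n := by
      rw [Fin.lt_def] at hlt
      rcases h' with rfl | rfl <;> rw [Fin.val_rev] at hlt <;> omega
    rcases lt_or_gt_of_ne hf with h1 | h1
    · have hleft : π.IsLeft (π.tilde p) := by rw [IsLeft, tilde_tilde]; exact ⟨h1, hp⟩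
      rcases h' with rfl | rfl
      · have := H.umat_inner hleft
        rw [tilde_tilde] at this
        exact hpq this
      · have := hUouter _ hleft
        rw [tilde_tilde] at this
        exact hpq this
    · have hleft : π.IsLeft p := ⟨h1, hhalf.2 hp⟩
      rcases h' with rfl | rfl
      · exact hpq (hU p hleft).2
      · exact hpq (hU p hleft).1
  · rw [eq_tilde_iff]
    by_contra hne
    have hl : π.label p = π.label q := by
      by_contra h'
      exact hpq (H.lblock p q hqp h')
    have h' := ((π.eq_of_label_eq hl).resolve_left hqp.ne).resolve_left hne
    by_cases hb : π.tilde p = p.rev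
    · rw [hb, Fin.rev_rev, or_iff_left hqp.ne] at h'
      exact hne (h'.trans hb.symm)
    by_cases hf : π.tilde p = p
    · rw [hf, or_self] at h'
      subst h'
      exact hpq (hfix p hf).2
    have hhalf := π.tilde_lt_iff hb
    have hpn := p.2
    have htn := (π.tilde p).2
    have hp : ¬ (p : ℕ) < n := by
      rw [Fin.lt_def] at hqp
      rcases h' with rfl | rfl <;> rw [Fin.val_rev] at hqp <;> omega
    rcases lt_or_gt_of_ne hf with h1 | h1
    · have hleft : π.IsLeft p.rev := by
        rw [IsLeft, tilde_rev, Fin.rev_lt_rev, Fin.val_rev]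
        exact ⟨h1, by omega⟩
      rcases h' with rfl | rfl
      · have := hLinner _ hleft
        rw [Fin.rev_rev] at this
        exact hpq this
      · have := hLouter _ hleft
        rw [tilde_rev, Fin.rev_rev] at this
        exact hpq this
    · have hleft : π.IsLeft (π.tilde p).rev := by
        rw [IsLeft, tilde_rev, tilde_tilde, Fin.rev_lt_rev, Fin.val_rev]
        exact ⟨h1, by omega⟩
      rcases h' with rfl | rfl
      · have := (hL _ hleft).2
        rw [tilde_rev, tilde_tilde, Fin.rev_rev] at this
        exact hpq this
      · have := (hL _ hleft).1
        rw [tilde_rev, tilde_tilde, Fin.rev_rev] at this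
        exact hpq this

/-- The order matters: clearing (p, p') uses that (p, q') is already clear, and the lower
elimination leaves the upper block untouched. -/
theorem IsReduced.mem_orbit (H : π.IsReduced M) : toMN n M ∈ orbit n π.family := by
  obtain ⟨g₁, h₁, hg₁, H₁, hU₁⟩ := H.exists_conj_kill_outer
  obtain ⟨g₂, h₂, hg₂, H₂, hU₂⟩ := H₁.exists_conj_kill_upper hU₁
  obtain ⟨g₃, h₃, hg₃, H₃, hU₃, hL₃⟩ := H₂.exists_conj_kill_lower
  refine mem_orbit_of_conj hg₁ (mem_orbit_of_conj hg₂ (mem_orbit_of_conj hg₃ ?_))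
  refine mem_orbit_of_mem (H₃.mem_family ?_ hL₃)
  rwa [hU₃]

theorem IsLift.mem_orbit (H : π.IsLift M)
    (hne : ∀ p q, π.label p ≠ π.label q → lmat n (M * M) p p ≠ lmat n (M * M) q q) :
    toMN n M ∈ orbit n π.family := by
  obtain ⟨g, h, hg, hU, hL⟩ := exists_conj_block_of_sq π.label π.label_rev M H.mem
    (fun p => H.umat_of_le le_rfl) H.sq hne
  exact mem_orbit_of_conj hg (IsReduced.mem_orbit ⟨H.conj_uni hg, hU, hL⟩)

end LinkPattern

namespace LinkPattern

variable {n : ℕ} {a : BType} {π : LinkPattern n a} {M : RZ n}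

/-! ### The two inclusions -/

theorem mem_F_iff [NeZero n] {m : MN n} : m ∈ π.F ↔ ∃ M, π.IsLift M ∧ toMN n M = m := by
  have hn : 0 < n := Nat.pos_of_ne_zero (NeZero.ne n)
  constructor
  · rintro ⟨⟨hm, hsq, -⟩, U, ⟨hU, hinv⟩, hP⟩
    obtain ⟨M, hM, rfl⟩ := hm
    have hdet : IsUnit U.1.det := (Matrix.isUnit_iff_isUnit_det _).1 U.isUnit
    rw [dag_eq] at hinv
    refine ⟨M, ⟨hM, ?_, U.1, U.1⁻¹, Matrix.mul_nonsing_inv _ hdet, Matrix.nonsing_inv_mul _ hdet,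
      fun p q h => hU p q h, fun p q h => ?_, hinv.symm, ?_⟩, rfl⟩
    · rw [map_mul, ← pow_two]; exact hsq
    · rw [hinv, dag_apply, hU _ _ (Fin.rev_lt_rev.2 h), mul_zero]
    · rw [← upperPart_toMN]; exact hP
  · rintro ⟨M, H, rfl⟩
    have hdiag : ∀ p, umat n M p p = 0 := fun p => H.umat_of_le le_rfl
    obtain ⟨A, B, hAB, hBA, hA, -, hd, hP⟩ := H.conj
    have hinv : A⁻¹ = B := Matrix.inv_eq_right_inv hAB
    refine ⟨⟨toMN_mem_MNa H.mem, by rw [pow_two, ← map_mul]; exact H.sq, fun i => ?_⟩,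
      ⟨A, B, hAB, hBA⟩, ⟨fun p q h => hA p q h, ?_⟩, ?_⟩
    · obtain ⟨p, m, rfl⟩ := exists_ix n i
      rw [entry_toMN _ _ _ (by omega), RZ.apply_ix, hdiag]
    · rw [dag_eq, hd]; exact hinv
    · rw [upperPart_toMN]
      change A * umat n M * A⁻¹ = _
      rw [hinv, hP]

/-- `P K Pᵀ + K Pᵀ P = K` for `P = π^a_<` and `K` the diagonal matrix of labels. -/
theorem upperMatrix_mul_add (π : LinkPattern n a) :
    let W : Matrix (Fin (2 * n)) (Fin (2 * n)) ℂ := .of fun p q => π.label p * π.lowerMatrix p q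
    π.upperMatrix * W + W * π.upperMatrix = Matrix.diagonal fun p => (π.label p : ℂ) := by
  intro W
  have h1 : ∀ p q, (π.upperMatrix * W) p q = π.upperMatrix p (π.tilde p) * W (π.tilde p) q := by
    intro p q
    rw [Matrix.mul_apply, Finset.sum_eq_single (π.tilde p)]
    · intro l _ hl
      rw [upperMatrix_apply, if_neg fun h => hl (π.eq_tilde_iff.1 h.2), zero_mul]
    · simp
  have h2 : ∀ p q, (W * π.upperMatrix) p q = W p (π.tilde p) * π.upperMatrix (π.tilde p) q := by
    intro p q
    rw [Matrix.mul_apply, Finset.sum_eq_single (π.tilde p)]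
    · intro l _ hl
      simp only [W, Matrix.of_apply]
      rw [lowerMatrix_apply, if_neg fun h => hl (π.eq_tilde_iff.1 h.2), mul_zero, zero_mul]
    · simp
  ext p q
  rw [Matrix.add_apply, h1, h2]
  simp only [W, Matrix.of_apply, upperMatrix_apply, lowerMatrix_apply, label_tilde, tilde_tilde,
    and_true]
  by_cases hpq : p = q
  · subst hpq
    rw [Matrix.diagonal_apply_eq]
    have hs := π.sign_comm (π.tilde_tilde p).symm
    have hs' := sign_mul_self (a := a) p (π.tilde p)
    rcases lt_trichotomy p (π.tilde p) with h | h | h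
    · simp only [h, h.not_gt, if_true, if_false, and_true, ← hs]
      linear_combination (π.label p : ℂ) * hs'
    -- At an unpaired index the left side vanishes, which is why the label there has to be 0.
    · have h0 : π.label p = 0 := if_pos h.symm
      simp [h0]
    · simp only [h, h.not_gt, if_true, if_false, and_true, ← hs]
      linear_combination (π.label p : ℂ) * hs'
  · have hne : π.tilde p ≠ π.tilde q := fun h => hpq (by
      rw [← π.tilde_tilde p, h, tilde_tilde])
    simp [hpq, hne]

variable [NeZero n]

theorem F_subset (π : LinkPattern n a) : π.F ⊆ zariskiClosure (orbit n π.family) := by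
  intro m hm
  obtain ⟨M, H, rfl⟩ := mem_F_iff.1 hm
  obtain ⟨A, B, hAB, hBA, hA, hB, hd, hP⟩ := H.conj
  set W : Matrix (Fin (2 * n)) (Fin (2 * n)) ℂ := .of fun p q => π.label p * π.lowerMatrix p q
    with hW
  set K : Matrix (Fin (2 * n)) (Fin (2 * n)) ℂ := Matrix.diagonal fun p => (π.label p : ℂ) with hK
  have hPW : π.upperMatrix * W + W * π.upperMatrix = K := π.upperMatrix_mul_add
  have hdW : dag n W = eta a • W := by
    ext p q
    have h1 : dag n π.lowerMatrix p q = _ := congrFun (congrFun π.dag_lowerMatrix p) q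
    rw [dag_apply, Matrix.smul_apply, smul_eq_mul] at h1
    rw [dag_apply, Matrix.smul_apply, smul_eq_mul]
    simp only [hW, Matrix.of_apply, label_rev]
    by_cases h : p = π.tilde q
    · rw [show π.label q = π.label p by rw [h, label_tilde]]
      linear_combination (π.label p : ℂ) * h1
    · have h2 : π.lowerMatrix p q = 0 := if_neg fun h' => h h'.2
      rw [h2, mul_zero] at h1
      rw [h2]
      linear_combination (π.label q : ℂ) * h1
  have hdA : dag n B = A := by rw [← hd, dag_dag]
  have hU : umat n M = B * π.upperMatrix * A := by
    rw [← hP, ← mul_assoc, ← mul_assoc, hBA, one_mul, mul_assoc, hBA, mul_one]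
  -- V transports W to the frame of M, so its anticommutator with the upper block is B K A:
  -- triangular, with the labels on its diagonal.
  set V := B * W * A with hV
  have hdV : dag n V = eta a • V := by
    rw [hV, dag_mul, dag_mul, hd, hdA, hdW, smul_mul_assoc, mul_smul_comm, mul_assoc]
  set L : RZ n := lift n 0 V with hL
  have huL : umat n L = 0 := umat_lift _ _ fun _ _ _ => rfl
  have hlL : lmat n L = V := lmat_lift _ _
  have hLmem : L ∈ RZa n a := by
    refine lift_mem_RZa _ _ ?_ hdV
    ext p q
    simp [dag_apply]
  have hUV : umat n M * V + V * umat n M = B * K * A := by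
    rw [hU, hV, ← hPW]
    calc B * π.upperMatrix * A * (B * W * A) + B * W * A * (B * π.upperMatrix * A)
        = B * π.upperMatrix * (A * B) * W * A + B * W * (A * B) * π.upperMatrix * A := by
          simp only [mul_assoc]
      _ = _ := by rw [hAB]; noncomm_ring
  have hKt : ∀ p q, q < p → K p q = 0 := fun p q h => Matrix.diagonal_apply_ne _ h.ne'
  have hsqU : ∀ c : ℂ, umat n ((M + c • L) * (M + c • L)) = 0 := fun c => by
    rw [umat_mul, map_add, map_smul, huL, smul_zero, add_zero, H.umat_sq]
  -- There is no c² term because L has zero upper block. As B K A has no strictly lower part, M + cL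
  -- still squares to zero modulo S^N.
  have hsqL : ∀ c : ℂ, lmat n ((M + c • L) * (M + c • L)) = lmat n (M * M) + c • (B * K * A) := by
    intro c
    rw [lmat_mul, lmat_mul, map_add, map_add, map_smul, map_smul, huL, hlL, ← hUV]
    simp only [smul_zero, add_zero, mul_add, add_mul, smul_add, mul_smul_comm, smul_mul_assoc]
    abel
  have hdiag : ∀ p, (B * K * A) p p = π.label p := fun p => by
    rw [triangular_mul_apply_self (triangular_mul hB hKt) hA, triangular_mul_apply_self hB hKt]
    have h1 := triangular_mul_apply_self hA hB p
    rw [hAB, Matrix.one_apply_eq] at h1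
    rw [hK, Matrix.diagonal_apply_eq]
    linear_combination -(π.label p : ℂ) * h1
  -- The excluded values of c are those for which two diagonal entries with different labels
  -- coincide.
  refine mem_zariskiClosure_of_line _ (toMN n L) (Set.finite_range
    fun pq : Fin (2 * n) × Fin (2 * n) =>
      (lmat n (M * M) pq.2 pq.2 - lmat n (M * M) pq.1 pq.1) / (π.label pq.1 - π.label pq.2 : ℂ))
    fun c hc => ?_
  rw [← map_smul, ← map_add]
  refine IsLift.mem_orbit (π := π) ⟨add_mem H.mem (Submodule.smul_mem _ _ hLmem), ?_,
    A, B, hAB, hBA, hA, hB, hd, ?_⟩ ?_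
  · refine toMN_eq_zero_iff.2 ⟨hsqU c, fun p q h => ?_⟩
    rw [hsqL, Matrix.add_apply, Matrix.smul_apply, (toMN_eq_zero_iff.1 H.sq).2 p q h,
      triangular_mul (triangular_mul hB hKt) hA p q h, smul_zero, add_zero]
  · rw [map_add, map_smul, huL, smul_zero, add_zero, hP]
  · intro p q hpq heq
    refine hc ⟨(p, q), ?_⟩
    rw [hsqL, Matrix.add_apply, Matrix.add_apply, Matrix.smul_apply, Matrix.smul_apply, hdiag,
      hdiag, smul_eq_mul, smul_eq_mul] at heq
    have hne : (π.label p - π.label q : ℂ) ≠ 0 := by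
      rw [sub_ne_zero]
      exact_mod_cast hpq
    rw [div_eq_iff hne]
    linear_combination -heq

/-- Two consecutive nonzero entries would apply π̃ twice and return to the starting index, which the
order conditions forbid; so X² vanishes modulo S^N. Diagonal symplectic rescaling absorbs σ. -/
theorem isLift_of_diagonal (π : LinkPattern n a) {X : RZ n} (hX : X ∈ RZa n a)
    {σ : Fin (2 * n) → ℂ} (hσ : ∀ p, σ p ≠ 0)
    (hU : umat n X = π.upperMatrix * Matrix.diagonal σ)
    (hL : ∀ p q, q < p → lmat n X p q = π.lowerMatrix p q * σ q) : π.IsLift X := by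
  have hUapp : ∀ p q, umat n X p q = π.upperMatrix p q * σ q := fun p q => by
    rw [hU, Matrix.mul_diagonal]
  have hUne : ∀ {p q}, umat n X p q ≠ 0 → p < q ∧ p = π.tilde q := fun {p q} h => by
    rw [hUapp, upperMatrix_apply] at h
    by_contra h'
    rw [if_neg h', zero_mul] at h
    exact h rfl
  have hLne : ∀ {p q}, q < p → lmat n X p q ≠ 0 → p = π.tilde q := fun {p q} hqp h => by
    rw [hL p q hqp, lowerMatrix_apply] at h
    by_contra h'
    rw [if_neg fun h'' => h' h''.2, zero_mul] at h
    exact h rfl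
  have hrev : ∀ {p}, p < π.tilde p → σ p.rev = σ (π.tilde p) := fun {p} hp => by
    have h1 : dag n (umat n X) p (π.tilde p) = _ := congrFun (congrFun (dag_umat_of_mem hX) p) _
    have h2 : dag n π.upperMatrix p (π.tilde p) = _ :=
      congrFun (congrFun π.dag_upperMatrix p) _
    rw [dag_apply, Matrix.smul_apply, smul_eq_mul] at h1 h2
    rw [hUapp, hUapp] at h1
    have h3 : π.upperMatrix p (π.tilde p) ≠ 0 := by
      rw [upperMatrix_apply, if_pos ⟨hp, (π.tilde_tilde p).symm⟩]
      intro h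
      have := sign_mul_self (a := a) p (π.tilde p)
      rw [h] at this
      simp at this
    have h4 : eta a ≠ 0 := fun h => by simpa [h] using eta_mul_self a
    refine mul_left_cancel₀ (mul_ne_zero h4 h3) ?_
    linear_combination h1 - σ p.rev * h2
  choose r hr using fun z : ℂ => IsAlgClosed.exists_pow_nat_eq z (n := 2) (by norm_num)
  have hr0 : ∀ z, z ≠ 0 → r z ≠ 0 := fun z hz h => hz (by rw [← hr z, h]; norm_num)
  -- Rescaling needs S_p / S_q = 1 / σ_q for p = π̃ q < q, and isometry needs S_p S_{p'} = 1.
  -- Splitting σ_q evenly by a square root gives both, since `hrev` makes σ agree at q and p' and r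
  -- is a fixed choice of root.
  let S : Fin (2 * n) → ℂ := fun p => if p < π.tilde p then (r (σ (π.tilde p)))⁻¹
    else if π.tilde p < p then r (σ p) else 1
  have hS1 : ∀ {p}, p < π.tilde p → S p * S p.rev = 1 := fun {p} hp => by
    have h1 : π.tilde p.rev < p.rev := by rwa [tilde_rev, Fin.rev_lt_rev]
    simp only [S, if_pos hp, if_neg h1.not_gt, if_pos h1, hrev hp]
    exact inv_mul_cancel₀ (hr0 _ (hσ _))
  have hS : ∀ p, S p * S p.rev = 1 := fun p => by
    rcases lt_trichotomy p (π.tilde p) with h | h | h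
    · exact hS1 h
    · have h1 : π.tilde p.rev = p.rev := by rw [tilde_rev, ← h]
      simp only [S, ← h, h1, lt_irrefl, if_false, mul_one]
    · have h1 := hS1 (p := p.rev) (by rwa [tilde_rev, Fin.rev_lt_rev])
      rwa [Fin.rev_rev, mul_comm] at h1
  have hAB : Matrix.diagonal S * Matrix.diagonal (fun p => S p.rev) = 1 := by
    rw [Matrix.diagonal_mul_diagonal]
    simp only [hS, Matrix.diagonal_one]
  have hBA : Matrix.diagonal (fun p => S p.rev) * Matrix.diagonal S = 1 := by
    rw [Matrix.diagonal_mul_diagonal]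
    simp only [fun p => mul_comm (S (Fin.rev p)) (S p), hS, Matrix.diagonal_one]
  refine ⟨hX, toMN_eq_zero_iff.2 ⟨?_, fun p q hqp => ?_⟩, Matrix.diagonal S,
    Matrix.diagonal (fun p => S p.rev), hAB, hBA, fun p q h => Matrix.diagonal_apply_ne _ h.ne',
    fun p q h => Matrix.diagonal_apply_ne _ h.ne', ?_, ?_⟩
  · ext p q
    rw [umat_mul, Matrix.mul_apply]
    refine Finset.sum_eq_zero fun l _ => ?_
    by_contra h
    have h1 := hUne (left_ne_zero_of_mul h)
    have h2 := hUne (right_ne_zero_of_mul h)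
    exact (h1.1.trans h2.1).ne (by rw [h1.2, h2.2, tilde_tilde])
  · rw [lmat_mul, Matrix.add_apply, Matrix.mul_apply, Matrix.mul_apply, Finset.sum_eq_zero,
      Finset.sum_eq_zero, add_zero]
    · intro l _
      by_contra h
      have h2 := hUne (right_ne_zero_of_mul h)
      have h1 := hLne (h2.1.trans hqp) (left_ne_zero_of_mul h)
      rw [h2.2, tilde_tilde] at h1
      exact hqp.ne' h1
    · intro l _
      by_contra h
      have h1 := hUne (left_ne_zero_of_mul h)
      have h2 := hLne (hqp.trans h1.1) (right_ne_zero_of_mul h)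
      rw [h2, tilde_tilde] at h1
      exact hqp.ne' h1.2
  · ext p q
    rw [dag_apply]
    by_cases h : p = q
    · subst h
      rw [Matrix.diagonal_apply_eq, Matrix.diagonal_apply_eq, sgn_mul_self, one_mul]
    · rw [Matrix.diagonal_apply_ne _ h, Matrix.diagonal_apply_ne _ (fun h' => h
        (Fin.rev_inj.1 h').symm), mul_zero]
  · ext p q
    rw [Matrix.mul_diagonal, Matrix.diagonal_mul, hUapp, upperMatrix_apply]
    split_ifs with h
    · obtain ⟨h1, rfl⟩ := h
      have h2 : S (π.tilde q) = (r (σ q))⁻¹ := by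
        simp only [S, tilde_tilde, if_pos h1]
      have h3 : S q.rev = (r (σ q))⁻¹ := by
        have h4 := hS q
        have h5 : S q = r (σ q) := by simp only [S, if_neg h1.not_gt, if_pos h1]
        rw [h5] at h4
        exact eq_inv_of_mul_eq_one_right h4
      have h6 := hr0 _ (hσ q)
      rw [h2, h3]
      nth_rewrite 2 [← hr (σ q)]
      field_simp
    · simp

theorem orbit_subset (π : LinkPattern n a) : orbit n π.family ⊆ zariskiClosure π.F := by
  intro m hm
  obtain ⟨g, h, hg, x, ⟨hx, t, ht, rfl⟩, rfl⟩ := mem_orbit_iff.1 hm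
  obtain ⟨X, hX, hXt⟩ := hx
  change toMN n X = _ at hXt
  set τ : Fin (2 * n) → ℂ := fun p => umat n t p p with hτ
  have hut : umat n t = Matrix.diagonal τ := by
    ext p q
    by_cases hpq : p = q
    · rw [hpq, Matrix.diagonal_apply_eq]
    · rw [Matrix.diagonal_apply_ne _ hpq]
      exact ht _ _ fun h' => hpq (ix_inj.1 h').2
  have hlt : lmat n t = 0 := by
    ext p q
    exact ht _ _ fun h' => zero_ne_one (ix_inj.1 h').1
  have hXU : umat n X = π.upperMatrix * Matrix.diagonal τ := by
    rw [(toMN_eq_iff.1 hXt).1, umat_mul, umat_matrix, hut]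
  have hXL : ∀ p q, q < p → lmat n X p q = π.lowerMatrix p q * τ q := fun p q hqp => by
    rw [(toMN_eq_iff.1 hXt).2 p q hqp, lmat_mul, lmat_matrix, hlt, hut, mul_zero, zero_add,
      Matrix.mul_diagonal]
  set Q : RZ n := lift n π.upperMatrix π.lowerMatrix with hQ
  have hQmem : Q ∈ RZa n a := lift_mem_RZa _ _ π.dag_upperMatrix π.dag_lowerMatrix
  have hQU : umat n Q = π.upperMatrix := umat_lift _ _ fun p q h => π.upperMatrix_of_le h.le
  have hQL : lmat n Q = π.lowerMatrix := lmat_lift _ _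
  -- Moving in the direction of the conjugate of π̲ replaces t by t + c; only the c that make a
  -- diagonal entry vanish are excluded.
  refine mem_zariskiClosure_of_line _ (toMN n (g * Q * h)) (Set.finite_range fun p => -τ p)
    fun c hc => ?_
  have heq : toMN n g * toMN n (π.matrix * t) * toMN n h + c • toMN n (g * Q * h)
      = toMN n (g * (X + c • Q) * h) := by
    rw [← hXt, mul_add, add_mul, mul_smul_comm, smul_mul_assoc, map_add, map_smul]
    simp only [map_mul]
  rw [heq]
  refine mem_F_iff.2 ⟨_, IsLift.conj_uni ?_ hg, rfl⟩
  refine π.isLift_of_diagonal (add_mem hX (Submodule.smul_mem _ _ hQmem))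
    (σ := fun p => τ p + c) (fun p h0 => hc ⟨p, ?_⟩) ?_ fun p q hqp => ?_
  · linear_combination -h0
  · ext p q
    rw [map_add, map_smul, hQU, hXU, Matrix.add_apply, Matrix.smul_apply, Matrix.mul_diagonal,
      Matrix.mul_diagonal, smul_eq_mul]
    ring
  · rw [map_add, map_smul, hQL, Matrix.add_apply, Matrix.smul_apply, hXL p q hqp, smul_eq_mul]
    ring

end LinkPattern
end BrauerLoop

theorem mainTheorem6 (n : ℕ) [NeZero n] (a : BrauerLoop.BType) (π : BrauerLoop.LinkPattern n a) :
    π.component = BrauerLoop.zariskiClosure (BrauerLoop.orbit n π.family) :=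
  (BrauerLoop.zariskiClosure_subset π.F_subset).antisymm
    (BrauerLoop.zariskiClosure_subset π.orbit_subset)
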